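/- **Setting.** Let $\Gamma_0,\Gamma_1,\Gamma_2,\dots$ be finite groups with $\Gamma_i\le\Gamma_{i+1}$ for $i\ge 1$, and let $H_0$ be a common subgroup of $\Gamma_0$ and $\Gamma_1$. Put $k=[\Gamma_0:H_0]$, and assume $k-1\ge 2$, $[\Gamma_1:H_0]\ge 2$ and $[\Gamma_i:\Gamma_{i-1}]\ge 2$ for $i\ge 2$. Attach $\Gamma_i$ to the vertex $x_i$ of an infinite ray $R=(x_0,x_1,\dots)$, attach $H_0$ to the edge $\{x_0,x_1\}$ and $\Gamma_i$ to the edge $\{x_i,x_{i+1}\}$ for $i\ge 1$. Let $\Gamma$ be the fundamental group of this graph of groups and $T$ its Bass–Serre tree: the vertices are the cosets $g\Gamma_i$ (with $x_i=\Gamma_i$), the edges are the pairs $\{gx_i,gx_{i+1}\}$, and $\Gamma$ acts by left multiplication. The level of a vertex $gx_i$ is $\ell(gx_i)=i$. Assume that $\Gamma$ is of *directly split Nagao type*: there are $H_0$-invariant subgroups $U_j\le\Gamma_j$ $(j\ge 1)$ with $\Gamma_i=H_0\ltimes(U_1\times\cdots\times U_i)$ for all $i\ge 1$; fix such subgroups.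 Each vertex $x$ with $\ell(x)>0$ is the origin of a unique ray along which the level increases by $1$ at each step. Let $\epsilon_x$ be its end, $\mathrm{HS}(x)$ the horosphere centred at $\epsilon_x$ containing $x$, and $\mathrm{HB}(x)$ the horoball centred at $\epsilon_x$ with boundary $\mathrm{HS}(x)$. Fix representatives $\gamma_1=1,\gamma_2,\dots,\gamma_k$ of the left cosets in $\Gamma_0/H_0$. Put $x_{i,s}=\gamma_sx_i$, $U_{j,s}=\gamma_sU_j\gamma_s^{-1}$ and $\Delta=\langle U_{j,s}\mid j\ge 1,\ 1\le s\le k\rangle$. * For $\ell(x)=i>0$ and $y\in\mathrm{HS}(x)$, choose $a\in\Delta$ and $s$ with $ax=x_{i,s}$, and let $\delta_{x,y}=a^{-1}da$, where $d$ is the unique element of $\langle U_{j,s}\mid j>i\rangle$ with $d(ax)=ay$; this does not depend on the choices. * For each vertex $x$ with $\ell(x)=i>0$ let $s$ be the unique index with $x\in\Delta x_{i,s}$, choose once and for all $\delta_x\in\Delta$ with $x=\delta_xx_{i,s}$, and put $\gamma_x=\delta_x\gamma_s$. For $\ell(x)=\ell(y)>0$ put $\gamma_{x,y}=\gamma_y\gamma_x^{-1}$.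 Let $i>0$. Let $T_i$ be the subforest of $T$ spanned by the vertices of level $\le i$, and $\mathcal C_i$ the set of its connected components. Let $\mathcal G_i$ be the graph with vertex set $\mathcal C_i$ in which $X\ne Y$ are adjacent if and only if there are $x\in X$, $y\in Y$ with $\ell(x)=\ell(y)=i$ and $y\in\mathrm{HS}(x)$; these $x,y$ are unique, and one sets $\tau_{X,Y}=\delta_{x,y}$. For arbitrary $X,Y\in\mathcal C_i$, set $\tau_{X,Y}=\tau_{X_{n-1},X_n}\cdots\tau_{X_0,X_1}$, where $X=X_0,X_1,\dots,X_n=Y$ is the unique geodesic from $X$ to $Y$ in $\mathcal G_i$ (so $\tau_{X,X}=1$). Let $L_i$ be the set of all level-preserving automorphisms $h$ of $T$ such that (a) $h|_{\mathrm{HB}(x)}=\gamma_{x,h(x)}|_{\mathrm{HB}(x)}$ for every vertex $x$ of level $i$; (b) $(h\tau_{X,Y}h^{-1})|_{h(X)}=\tau_{h(X),h(Y)}|_{h(X)}$ for all $X,Y\in\mathcal C_i$. **Proposition.** For all choices above and every $i>0$, $L_i$ is a subgroup of $\mathrm{Aut}(T)$, and for any $X,Y\in\mathcal C_i$ and any level-preserving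 isomorphism $h:X\to Y$ there is a unique $E(h)\in L_i$ that extends $h$. -/

import Mathlib

universe u

/-- A ray of finite groups: vertex groups `G 0, G 1, G 2, …`, with the group `H` attached to the
first edge (embedded in `G 0` and `G 1`), and `G (i+1)` attached to the edge joining the vertices
`i+1` and `i+2` (embedded in `G (i+2)`).  The last three fields say that
`q₀ = [G 0 : H] - 1`, `q₁ = [G 1 : H]` and `qᵢ₊₂ = [G (i+2) : G (i+1)]` are all at least `2`. -/
structure NagaoRay where
  G : ℕ → Type u
  [group : ∀ i, Group (G i)]
  [finite : ∀ i, Finite (G i)]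
  H : Type u
  [groupH : Group H]
  inc₀ : H →* G 0
  inc₁ : H →* G 1
  inc : ∀ i, G (i + 1) →* G (i + 2)
  inc₀_injective : Function.Injective inc₀
  inc₁_injective : Function.Injective inc₁
  inc_injective : ∀ i, Function.Injective (inc i)
  three_le_index : 3 ≤ inc₀.range.index
  two_le_index_one : 2 ≤ inc₁.range.index
  two_le_index : ∀ i, 2 ≤ (inc i).range.index

attribute [instance] NagaoRay.group NagaoRay.finite NagaoRay.groupH

namespace NagaoRay

variable (N : NagaoRay.{u})

/-- The integer `k = [Γ₀ : H₀]`. -/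
noncomputable def k : ℕ := N.inc₀.range.index

/-- The edge relations: each edge group is identified with its two images in the
adjacent vertex groups. -/
def edgeRels : Set (Monoid.CoprodI N.G) :=
  {w | ∃ h : N.H, w = Monoid.CoprodI.of (N.inc₀ h) * (Monoid.CoprodI.of (N.inc₁ h))⁻¹} ∪
  {w | ∃ (i : ℕ) (g : N.G (i + 1)),
    w = Monoid.CoprodI.of g * (Monoid.CoprodI.of (N.inc i g))⁻¹}

/-- The fundamental group `Γ` of the ray of groups: the free product of the vertex groups modulo
the edge relations (the underlying graph is a tree, so there are no further generators). -/
abbrev Gam : Type u := Monoid.CoprodI N.G ⧸ Subgroup.normalClosure N.edgeRels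

/-- The canonical map from the `i`-th vertex group to `Γ`. -/
def of (i : ℕ) : N.G i →* N.Gam :=
  (QuotientGroup.mk' (Subgroup.normalClosure N.edgeRels)).comp Monoid.CoprodI.of

/-- The vertex group `Γᵢ` as a subgroup of `Γ`. -/
def vertexGroup (i : ℕ) : Subgroup N.Gam := (N.of i).range

/-- The group `H₀` of the first edge as a subgroup of `Γ`. -/
def edgeGroup : Subgroup N.Gam := ((N.of 0).comp N.inc₀).range

/-- The vertices of the Bass-Serre tree `T`: the cosets of the vertex groups.
The group `Γ` acts on them by left multiplication. -/
abbrev Vertex : Type u := Σ i : ℕ, N.Gam ⧸ N.vertexGroup i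

variable {N} in
/-- The level of a vertex: the index of its `Γ`-orbit. -/
def level (v : N.Vertex) : ℕ := v.1

/-- The vertex `xᵢ` of the base ray `R`. -/
def baseVertex (i : ℕ) : N.Vertex := ⟨i, ((1 : N.Gam) : N.Gam ⧸ N.vertexGroup i)⟩

/-- The Bass-Serre tree `T`: its edges are the `Γ`-translates of the edges `{xᵢ, xᵢ₊₁}`. -/
def tree : SimpleGraph N.Vertex :=
  SimpleGraph.fromRel fun v w =>
    ∃ (g : N.Gam) (i : ℕ), v = g • N.baseVertex i ∧ w = g • N.baseVertex (i + 1)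

/-- The automorphism group of `T`. -/
abbrev AutT : Type u := N.tree ≃g N.tree

variable {N} in
/-- Automorphisms of `T` that preserve the level function, i.e. elements of `L`. -/
def LevelPreserving (h : N.AutT) : Prop := ∀ v, level (h v) = level v

/-! ### Horospheres and horoballs -/

variable {N} in
/-- `r` is a level-increasing ray of `T` starting in `x`. -/
def IsLevelRay (x : N.Vertex) (r : ℕ → N.Vertex) : Prop :=
  r 0 = x ∧ (∀ n, N.tree.Adj (r n) (r (n + 1))) ∧ ∀ n, level (r n) = level x + n

variable {N} in
/-- The horosphere through `x` centered at the end of the level-increasing ray `r` from `x`: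
the zero set of the Busemann function `y ↦ lim (dist y (r n) - n)`. -/
def HS (x : N.Vertex) : Set N.Vertex :=
  {y | ∃ r, IsLevelRay x r ∧ ∀ᶠ n in Filter.atTop, N.tree.dist y (r n) = n}

variable {N} in
/-- The horoball bounded by the horosphere `HS x`: the set where the Busemann function
`y ↦ lim (dist y (r n) - n)` is at most `0`. -/
def HB (x : N.Vertex) : Set N.Vertex :=
  {y | ∃ r, IsLevelRay x r ∧ ∀ᶠ n in Filter.atTop, N.tree.dist y (r n) ≤ n}

/-! ### Components of bounded level -/

/-- The subforest `Tᵢ` spanned by the vertices of level at most `i`. -/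
abbrev forest (i : ℕ) : SimpleGraph {v : N.Vertex | level v ≤ i} :=
  N.tree.induce {v | level v ≤ i}

/-- The set `𝒞ᵢ` of (vertex sets of) connected components of `Tᵢ`. -/
def components (i : ℕ) : Set (Set N.Vertex) :=
  Set.range fun c : (N.forest i).ConnectedComponent => Subtype.val '' c.supp

/-- The graph `𝒢ᵢ` with vertex set `𝒞ᵢ`. -/
def compGraph (i : ℕ) : SimpleGraph (N.components i) :=
  SimpleGraph.fromRel fun X Y =>
    ∃ x ∈ X.1, ∃ y ∈ Y.1, level x = i ∧ level y = i ∧ y ∈ HS x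

variable {N} in
/-- A level-preserving automorphism of `T` restricts to an automorphism of `Tᵢ`. -/
def forestIso (h : N.AutT) (hl : LevelPreserving h) (i : ℕ) : N.forest i ≃g N.forest i where
  toEquiv := h.toEquiv.subtypeEquiv fun v => by
    change level v ≤ i ↔ level (h v) ≤ i
    rw [hl v]
  map_rel_iff' := by
    intro a b
    exact h.map_adj_iff

variable {N} in
theorem image_mem_components (h : N.AutT) (hl : LevelPreserving h) {i : ℕ}
    {X : Set N.Vertex} (hX : X ∈ N.components i) : h '' X ∈ N.components i := by
  obtain ⟨c, rfl⟩ := hX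
  refine ⟨c.map (forestIso h hl i).toHom, ?_⟩
  induction c using SimpleGraph.ConnectedComponent.ind with
  | h v =>
    ext w
    simp only [Set.mem_image, SimpleGraph.ConnectedComponent.mem_supp_iff,
      SimpleGraph.ConnectedComponent.map_mk, SimpleGraph.ConnectedComponent.eq]
    constructor
    · rintro ⟨a, ha, rfl⟩
      obtain ⟨b, rfl⟩ := (forestIso h hl i).surjective a
      exact ⟨b.1, ⟨b, (forestIso h hl i).reachable_iff.1 ha, rfl⟩, rfl⟩
    · rintro ⟨_, ⟨b, hb, rfl⟩, rfl⟩
      exact ⟨forestIso h hl i b, (forestIso h hl i).reachable_iff.2 hb, rfl⟩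

variable {N} in
/-- The component `h(X)`. -/
def mapComp (h : N.AutT) (hl : LevelPreserving h) {i : ℕ} (X : N.components i) :
    N.components i :=
  ⟨h '' X.1, image_mem_components h hl X.2⟩

/-! ### Directly split type, the group `Δ` and the maps `δ`, `τ`, `γ` -/

/-- A choice of root groups `Uⱼ` showing that `Γ` is of directly split Nagao type:
`H₀`-invariant subgroups `Uⱼ ≤ Γⱼ` for `j > 0` with `Γᵢ = H₀ ⋉ (U₁ × ⋯ × Uᵢ)` for all `i > 0`.
(There is no `U₀` in the mathematics; the value `U 0` is set to be trivial.) -/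
structure DirectSplitting where
  U : ℕ → Subgroup N.Gam
  U_zero : U 0 = ⊥
  U_le : ∀ j, 0 < j → U j ≤ N.vertexGroup j
  U_invariant : ∀ j, 0 < j → ∀ h ∈ N.edgeGroup, ∀ u ∈ U j, h * u * h⁻¹ ∈ U j
  U_commute : ∀ j l, j ≠ l → ∀ a ∈ U j, ∀ b ∈ U l, Commute a b
  U_indep : iSupIndep U
  disjoint : ∀ i, 0 < i → Disjoint N.edgeGroup (⨆ j ≤ i, U j)
  sup_eq : ∀ i, 0 < i → N.edgeGroup ⊔ (⨆ j ≤ i, U j) = N.vertexGroup i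

/-- A system `γ₁ = 1, γ₂, …, γₖ` of representatives of the left cosets in `Γ₀ / H₀`
(numbered from `0` here). -/
structure CosetReps where
  rep : Fin N.k → N.G 0
  rep_first : ∀ s : Fin N.k, (s : ℕ) = 0 → rep s = 1
  rep_bijective : Function.Bijective fun s => (rep s : N.G 0 ⧸ N.inc₀.range)

variable {N}

/-- The representative `γₛ` as an element of `Γ`. -/
def CosetReps.gam (C : N.CosetReps) (s : Fin N.k) : N.Gam := N.of 0 (C.rep s)

variable (S : N.DirectSplitting) (C : N.CosetReps)

/-- The set `Uⱼ,ₛ = γₛ Uⱼ γₛ⁻¹`. -/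
def rootConj (j : ℕ) (s : Fin N.k) : Set N.Gam :=
  {g | ∃ u ∈ S.U j, g = C.gam s * u * (C.gam s)⁻¹}

/-- The group `Δ`, generated by all `Uⱼ,ₛ` with `j > 0`. -/
def Delta : Subgroup N.Gam :=
  Subgroup.closure {g | ∃ (j : ℕ) (s : Fin N.k), 0 < j ∧ g ∈ rootConj S C j s}

/-- The group generated by the `Uⱼ,ₛ` with `j > i`. -/
def upperGroup (i : ℕ) (s : Fin N.k) : Subgroup N.Gam :=
  Subgroup.closure {g | ∃ j : ℕ, i < j ∧ g ∈ rootConj S C j s}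

/-- `d` is obtained by the defining recipe of `δ_{x,y}`: some `a ∈ Δ` moves `x` to a vertex
`x_{i,s} = γₛ xᵢ` of the fundamental domain, and `a d a⁻¹` is the element of `⟨Uⱼ,ₛ ∣ j > i⟩`
that maps `a x` to `a y`. -/
def IsDelta (x y : N.Vertex) (d : N.Gam) : Prop :=
  ∃ a ∈ Delta S C, ∃ s : Fin N.k,
    a • x = C.gam s • N.baseVertex (level x) ∧
    a * d * a⁻¹ ∈ upperGroup S C (level x) s ∧ (a * d * a⁻¹) • (a • x) = a • y

/-- The element `δ_{x,y}` of `Δ`, for `level x > 0` and `y ∈ HS x`: the element `d`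
with `IsDelta S C x y d`. -/
noncomputable def delta (x y : N.Vertex) : N.Gam := Classical.epsilon (IsDelta S C x y)

/-- `τ_{X,Y}` for adjacent `X`, `Y`: the element `δ_{x,y}`, where `x ∈ X` and `y ∈ Y` are the
vertices of level `i` with `y ∈ HS x`. -/
noncomputable def tauEdge (i : ℕ) (X Y : N.components i) : N.Gam :=
  Classical.epsilon fun d => ∃ x ∈ X.1, ∃ y ∈ Y.1,
    level x = i ∧ level y = i ∧ y ∈ HS x ∧ d = delta S C x y

/-- The product `τ_{Xₙ₋₁,Xₙ} ⋯ τ_{X₀,X₁}` along a walk `X₀, …, Xₙ` in `𝒢ᵢ`. -/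
noncomputable def tauWalk (i : ℕ) :
    {X Y : N.components i} → (N.compGraph i).Walk X Y → N.Gam
  | _, _, .nil => 1
  | X, _, .cons (v := Z) _ p => tauWalk i p * tauEdge S C i X Z

/-- `τ_{X,Y}`: the product along the geodesic of `𝒢ᵢ` from `X` to `Y`. -/
noncomputable def tau (i : ℕ) (X Y : N.components i) : N.Gam :=
  Classical.epsilon fun t => ∃ p : (N.compGraph i).Walk X Y,
    p.length = (N.compGraph i).dist X Y ∧ t = tauWalk S C i p

/-- The choice, for every vertex `x` of positive level `i`, of an element `δₓ ∈ Δ` and of the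
index `s = s(x)` with `x = δₓ x_{i,s} = δₓ γₛ xᵢ`. -/
structure VertexReps where
  del : N.Vertex → N.Gam
  idx : N.Vertex → Fin N.k
  del_mem : ∀ x, 0 < level x → del x ∈ Delta S C
  del_smul : ∀ x, 0 < level x → (del x * C.gam (idx x)) • N.baseVertex (level x) = x

variable {S C} (D : VertexReps S C)

/-- The element `γₓ = δₓ γₛ`. -/
def VertexReps.gam (x : N.Vertex) : N.Gam := D.del x * C.gam (D.idx x)

/-- The element `γ_{x,y} = γ_y γₓ⁻¹`, for vertices `x`, `y` of the same positive level. -/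
def VertexReps.gam₂ (x y : N.Vertex) : N.Gam := D.gam y * (D.gam x)⁻¹

/-- The set `Lᵢ` of the level-preserving automorphisms `h` of `T` such that
(a) `h` agrees with `γ_{x,h(x)}` on `HB x` for all vertices `x` of level `i`, and
(b) `h τ_{X,Y} h⁻¹` agrees with `τ_{h(X),h(Y)}` on `h(X)` for all `X, Y ∈ 𝒞ᵢ`. -/
def VertexReps.L (i : ℕ) : Set N.AutT :=
  {h | ∃ hl : LevelPreserving h,
    (∀ x : N.Vertex, level x = i → ∀ v ∈ HB x, h v = D.gam₂ x (h x) • v) ∧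
    ∀ X Y : N.components i, ∀ v ∈ (mapComp h hl X).1,
      h (tau S C i X Y • h.symm v) = tau S C i (mapComp h hl X) (mapComp h hl Y) • v}

end NagaoRay

/-! Fix `i > 0`. The union of the `Γⱼ` with `j > 0` (`rayGroup`) is a semidirect product of `W = ⟨Uⱼ
∣ j > i⟩` (`upper`) and `Γᵢ`. As `Γ` is the amalgam of `Γ₀` and this union over `H₀`, it retracts
onto the group `A` generated by `Γ₀, …, Γᵢ` (`lowGroup`), with `W` sent to `1`. Let `K` be the
kernel (`kern`). It is generated by the groups `a W a⁻¹` with `a ∈ A`, and it acts simply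
transitively on `𝒞ᵢ`: each component is `κ` times the component of `x₀` for a unique `κ ∈ K`. For `i
= 0` the kernel is `Δ`.

Each `δ_{x,y}` lies in `K`, so the products along walks telescope and `τ_{X,Y}` is the only element
of `K` taking `X` to `Y` (`tau_comp`). Hence (b) holds for every automorphism that is equivariant
over an endomorphism of `K`.

Uniqueness: if two elements of `Lᵢ` agree on `X` and `Y` is adjacent to `X`, then (a) shows that
they send `Y` to the same component, and (b) transfers agreement from `X` to `Y`. The graph `𝒢ᵢ` is
connected, and (a) settles the levels above `i`.

Existence: after translation by `K` both components are that of `x₀`. Let `c x` be the translated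
element `γ_{x,h(x)}`. The extension is `E (κ v) = φ(κ) E v`, where `φ : K → K` has to conjugate `a W
a⁻¹` by `c (a xᵢ)`; such a `φ` exists by `exists_twist`, via a wreath product. `exists_isExtension`
shows that `E` is well defined, and the same construction for `h⁻¹` inverts it. Condition (a)
spreads from one component to all by `gam₂_smul`: up to an element of `U₁ ⋯ Uᵢ`, `γ_{dx}` equals `d
γₓ` for `d ∈ Δ`, and `U₁ ⋯ Uᵢ` fixes the horoball at `xᵢ` pointwise because it commutes with `W`. -/

section GroupLemmas

/-! ### Semidirect products inside a group. -/

variable {G : Type*} [Group G]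

/-- If `W` is normalized by `B`, then `B ⊔ W = W B`. -/
theorem Subgroup.exists_mul_of_mem_sup_of_conj_mem {W B : Subgroup G}
    (hn : ∀ b ∈ B, ∀ w ∈ W, b * w * b⁻¹ ∈ W) {p : G} (hp : p ∈ B ⊔ W) :
    ∃ w ∈ W, ∃ b ∈ B, p = w * b := by
  rw [Subgroup.sup_eq_closure] at hp
  induction hp using Subgroup.closure_induction with
  | mem x hx =>
    rcases hx with hx | hx
    · exact ⟨1, W.one_mem, x, hx, by simp⟩
    · exact ⟨x, hx, 1, B.one_mem, by simp⟩
  | one => exact ⟨1, W.one_mem, 1, B.one_mem, by simp⟩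
  | mul x y _ _ hx hy =>
    obtain ⟨w, hw, b, hb, rfl⟩ := hx
    obtain ⟨w', hw', b', hb', rfl⟩ := hy
    exact ⟨w * (b * w' * b⁻¹), W.mul_mem hw (hn b hb w' hw'), b * b', B.mul_mem hb hb', by group⟩
  | inv x _ hx =>
    obtain ⟨w, hw, b, hb, rfl⟩ := hx
    exact ⟨b⁻¹ * w⁻¹ * b⁻¹⁻¹, hn _ (B.inv_mem hb) _ (W.inv_mem hw), b⁻¹, B.inv_mem hb, by group⟩

/-- The retraction of a semidirect product `P = W ⋊ B` onto `B`. -/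
theorem Subgroup.exists_retraction {P W B : Subgroup G}
    (hP : ∀ p ∈ P, ∃ w ∈ W, ∃ b ∈ B, p = w * b)
    (hn : ∀ p ∈ P, ∀ w ∈ W, p * w * p⁻¹ ∈ W) (hd : Disjoint W B) :
    ∃ r : P →* G, ∀ p : P, r p ∈ B ∧ ∀ w ∈ W, ∀ b ∈ B, (p : G) = w * b → r p = b := by
  have key : ∀ p : P, ∃ b ∈ B, ∃ w ∈ W, (p : G) = w * b := fun p => by
    obtain ⟨w, hw, b, hb, h⟩ := hP p p.2
    exact ⟨b, hb, w, hw, h⟩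
  choose r hr w hw hp using key
  have huniq : ∀ w₁ ∈ W, ∀ b₁ ∈ B, ∀ w₂ ∈ W, ∀ b₂ ∈ B, w₁ * b₁ = w₂ * b₂ → b₁ = b₂ := by
    intro w₁ h₁ b₁ hb₁ w₂ h₂ b₂ hb₂ h
    have e : w₂⁻¹ * w₁ = b₂ * b₁⁻¹ := by
      rw [eq_mul_inv_iff_mul_eq, mul_assoc, h, inv_mul_cancel_left]
    have := Subgroup.disjoint_def.1 hd (W.mul_mem (W.inv_mem h₂) h₁)
      (e ▸ B.mul_mem hb₂ (B.inv_mem hb₁))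
    rw [e] at this
    exact (mul_inv_eq_one.1 this).symm
  refine ⟨MonoidHom.mk' r fun p q => ?_, fun p => ⟨hr p, fun w' hw' b hb h =>
    huniq _ (hw p) _ (hr p) _ hw' _ hb ((hp p).symm.trans h)⟩⟩
  -- Moving `w q` to the left across `p` gives `p q = (p w(q) p⁻¹ w(p)) (r(p) r(q))`, and the first
  -- factor is in `W` by normality.
  refine huniq _ (hw (p * q)) _ (hr _) (p * w q * (p : G)⁻¹ * w p) ?_ _
    (B.mul_mem (hr p) (hr q)) ?_
  · exact W.mul_mem (hn p p.2 _ (hw q)) (hw p)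
  · rw [← hp (p * q)]
    have h1 : w p = p * (r p)⁻¹ := by rw [eq_mul_inv_iff_mul_eq, ← hp p]
    have h2 : w q = q * (r q)⁻¹ := by rw [eq_mul_inv_iff_mul_eq, ← hp q]
    rw [h1, h2, Subgroup.coe_mul]
    group

end GroupLemmas

/-! ### The group `Γ` as an amalgam. -/

namespace NagaoRay

variable {N : NagaoRay.{u}}

theorem of_inc₀ (h : N.H) : N.of 0 (N.inc₀ h) = N.of 1 (N.inc₁ h) := by
  rw [← mul_inv_eq_one, ← map_inv]
  refine (QuotientGroup.eq_one_iff _).2 (Subgroup.subset_normalClosure (Or.inl ⟨h, ?_⟩))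
  rw [map_inv]

theorem of_inc (i : ℕ) (g : N.G (i + 1)) : N.of (i + 1) g = N.of (i + 2) (N.inc i g) := by
  rw [← mul_inv_eq_one, ← map_inv]
  refine (QuotientGroup.eq_one_iff _).2 (Subgroup.subset_normalClosure (Or.inr ⟨i, g, ?_⟩))
  rw [map_inv]

theorem vertexGroup_le_succ (m : ℕ) : N.vertexGroup (m + 1) ≤ N.vertexGroup (m + 2) := by
  rintro _ ⟨g, rfl⟩
  exact ⟨N.inc m g, (of_inc m g).symm⟩

theorem vertexGroup_succ_mono : Monotone fun m => N.vertexGroup (m + 1) :=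
  monotone_nat_of_le_succ vertexGroup_le_succ

theorem vertexGroup_mono {l m : ℕ} (hl : 0 < l) (h : l ≤ m) :
    N.vertexGroup l ≤ N.vertexGroup m := by
  obtain ⟨l, rfl⟩ := Nat.exists_eq_succ_of_ne_zero hl.ne'
  obtain ⟨m, rfl⟩ := Nat.exists_eq_succ_of_ne_zero (hl.trans_le h).ne'
  exact vertexGroup_succ_mono (Nat.succ_le_succ_iff.1 h)

theorem edgeGroup_le_zero : N.edgeGroup ≤ N.vertexGroup 0 := by
  rintro _ ⟨h, rfl⟩
  exact ⟨N.inc₀ h, rfl⟩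

theorem edgeGroup_le {m : ℕ} (hm : 0 < m) : N.edgeGroup ≤ N.vertexGroup m := by
  refine le_trans ?_ (vertexGroup_mono one_pos hm)
  rintro _ ⟨h, rfl⟩
  exact ⟨N.inc₁ h, (of_inc₀ h).symm⟩

theorem iSup_vertexGroup : ⨆ m, N.vertexGroup m = ⊤ := by
  rw [eq_top_iff]
  rintro g -
  obtain ⟨w, rfl⟩ := QuotientGroup.mk'_surjective _ g
  induction w using Monoid.CoprodI.induction_on with
  | one => exact Subgroup.one_mem _
  | of i m => exact Subgroup.mem_iSup_of_mem i ⟨m, rfl⟩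
  | mul x y hx hy => rw [map_mul]; exact Subgroup.mul_mem _ hx hy

variable (N) in
/-- The union of the vertex groups of positive level. -/
def rayGroup : Subgroup N.Gam := ⨆ m, N.vertexGroup (m + 1)

theorem mem_rayGroup {g : N.Gam} : g ∈ N.rayGroup ↔ ∃ m, g ∈ N.vertexGroup (m + 1) :=
  Subgroup.mem_iSup_of_directed vertexGroup_succ_mono.directed_le

theorem vertexGroup_le_rayGroup {m : ℕ} (hm : 0 < m) : N.vertexGroup m ≤ N.rayGroup := by
  obtain ⟨m, rfl⟩ := Nat.exists_eq_succ_of_ne_zero hm.ne'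
  exact le_iSup (fun m => N.vertexGroup (m + 1)) m

theorem edgeGroup_le_rayGroup : N.edgeGroup ≤ N.rayGroup :=
  (edgeGroup_le one_pos).trans (vertexGroup_le_rayGroup one_pos)

/-- Two homomorphisms on `Γ` agree if they agree on `Γ₀` and on `Γᵢ` for all `i > 0`. -/
theorem Gam_hom_ext {M : Type*} [Group M] {f g : N.Gam →* M}
    (h₀ : ∀ z ∈ N.vertexGroup 0, f z = g z) (h : ∀ p ∈ N.rayGroup, f p = g p) : f = g := by
  have : (⊤ : Subgroup N.Gam) ≤ f.eqLocus g := by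
    rw [← iSup_vertexGroup]
    refine iSup_le fun m => ?_
    rcases m.eq_zero_or_pos with rfl | hm
    · exact h₀
    · exact fun p hp => h p (vertexGroup_le_rayGroup hm hp)
  exact MonoidHom.ext fun x => this (Subgroup.mem_top x)

/-- The universal property of `Γ`. -/
theorem exists_Gam_hom {M : Type*} [Group M] (f : ∀ m, N.G m →* M)
    (h₀ : ∀ x, f 0 (N.inc₀ x) = f 1 (N.inc₁ x))
    (h : ∀ m g, f (m + 1) g = f (m + 2) (N.inc m g)) :
    ∃ Φ : N.Gam →* M, ∀ m g, Φ (N.of m g) = f m g := by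
  have hf : Subgroup.normalClosure N.edgeRels ≤ (Monoid.CoprodI.lift f).ker := by
    refine Subgroup.normalClosure_le_normal ?_
    rintro _ (⟨x, rfl⟩ | ⟨m, g, rfl⟩)
    · rw [SetLike.mem_coe, MonoidHom.mem_ker, map_mul, map_inv, mul_inv_eq_one,
        Monoid.CoprodI.lift_of, Monoid.CoprodI.lift_of]
      exact h₀ x
    · rw [SetLike.mem_coe, MonoidHom.mem_ker, map_mul, map_inv, mul_inv_eq_one,
        Monoid.CoprodI.lift_of, Monoid.CoprodI.lift_of]
      exact h m g
  exact ⟨QuotientGroup.lift _ (Monoid.CoprodI.lift f) hf, fun m g =>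
    (QuotientGroup.lift_mk' _ hf _).trans (Monoid.CoprodI.lift_of _ _)⟩

/-- The group `Γ` is the amalgam of `Γ₀` and the union of the `Γᵢ` with `i > 0`. -/
theorem exists_Gam_hom_of_rayGroup {M : Type*} [Group M] (f₀ : N.G 0 →* M)
    (F : N.rayGroup →* M)
    (h : ∀ (x : N.H) (hx : N.of 0 (N.inc₀ x) ∈ N.rayGroup), F ⟨_, hx⟩ = f₀ (N.inc₀ x)) :
    ∃ Φ : N.Gam →* M, (∀ z, Φ (N.of 0 z) = f₀ z) ∧ ∀ p : N.rayGroup, Φ p = F p := by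
  let ι : ∀ m, N.G (m + 1) →* N.rayGroup := fun m => (N.of (m + 1)).codRestrict _
    fun g => mem_rayGroup.2 ⟨m, g, rfl⟩
  let f : ∀ m, N.G m →* M := fun m => match m with
    | 0 => f₀
    | m + 1 => F.comp (ι m)
  obtain ⟨Φ, hΦ⟩ := exists_Gam_hom f
    (fun x => (h x (edgeGroup_le_rayGroup ⟨x, rfl⟩)).symm.trans
      (congrArg F (Subtype.ext (of_inc₀ x))))
    (fun m g => congrArg F (Subtype.ext (of_inc m g)))
  refine ⟨Φ, hΦ 0, ?_⟩
  rintro ⟨p, hp⟩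
  obtain ⟨m, g, rfl⟩ := mem_rayGroup.1 hp
  exact hΦ (m + 1) g

/-! ### The retractions of `Γ` -/

variable (N) in
/-- The group generated by the vertex groups of level at most `i`. -/
def lowGroup (i : ℕ) : Subgroup N.Gam := ⨆ m ≤ i, N.vertexGroup m

theorem vertexGroup_le_lowGroup {m i : ℕ} (h : m ≤ i) : N.vertexGroup m ≤ N.lowGroup i :=
  le_iSup₂ (f := fun m (_ : m ≤ i) => N.vertexGroup m) m h

theorem edgeGroup_le_lowGroup (i : ℕ) : N.edgeGroup ≤ N.lowGroup i :=
  edgeGroup_le_zero.trans (vertexGroup_le_lowGroup (Nat.zero_le i))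

theorem exists_mem_lowGroup (g : N.Gam) : ∃ i, g ∈ N.lowGroup i := by
  have hd : Directed (· ≤ ·) N.lowGroup := by
    refine Monotone.directed_le fun i j hij => iSup₂_le fun m hm => ?_
    exact vertexGroup_le_lowGroup (hm.trans hij)
  rw [← Subgroup.mem_iSup_of_directed hd]
  have : ⨆ m, N.vertexGroup m ≤ ⨆ i, N.lowGroup i :=
    iSup_mono fun m => vertexGroup_le_lowGroup le_rfl
  exact this (iSup_vertexGroup (N := N) ▸ Subgroup.mem_top g)

namespace DirectSplitting

variable (S : N.DirectSplitting) (i : ℕ)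

/-- The group generated by all `Uⱼ` with `j > i`. -/
def upper : Subgroup N.Gam := ⨆ j, ⨆ (_ : i < j), S.U j

/-- The group generated by all `Uⱼ` with `j ≤ i`. -/
def lower : Subgroup N.Gam := ⨆ j ≤ i, S.U j

variable {S i}

theorem U_le_upper {j : ℕ} (h : i < j) : S.U j ≤ S.upper i :=
  le_iSup₂ (f := fun j (_ : i < j) => S.U j) j h

theorem U_le_lower {j : ℕ} (h : j ≤ i) : S.U j ≤ S.lower i :=
  le_iSup₂ (f := fun j (_ : j ≤ i) => S.U j) j h

theorem U_le_rayGroup (j : ℕ) : S.U j ≤ N.rayGroup := by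
  rcases j.eq_zero_or_pos with rfl | hj
  · rw [S.U_zero]; exact bot_le
  · exact (S.U_le j hj).trans (vertexGroup_le_rayGroup hj)

theorem upper_le_rayGroup : S.upper i ≤ N.rayGroup := iSup₂_le fun j _ => U_le_rayGroup j

theorem lower_le_vertexGroup (hi : 0 < i) : S.lower i ≤ N.vertexGroup i :=
  le_sup_right.trans (S.sup_eq i hi).le

theorem vertexGroup_eq (hi : 0 < i) : N.vertexGroup i = N.edgeGroup ⊔ S.lower i :=
  (S.sup_eq i hi).symm

/-- This is where the splitting being direct enters: generators with distinct indices commute, and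
the index ranges `j ≤ i` and `l > i` do not meet. -/
theorem commute_lower_upper {a b : N.Gam} (ha : a ∈ S.lower i) (hb : b ∈ S.upper i) :
    Commute a b := by
  have h : S.lower i ≤ Subgroup.centralizer (S.upper i : Set N.Gam) := by
    refine iSup₂_le fun j hj => ?_
    rw [Subgroup.le_centralizer_iff]
    refine iSup₂_le fun l hl => ?_
    rw [Subgroup.le_centralizer_iff]
    intro a ha
    rw [Subgroup.mem_centralizer_iff]
    intro b hb
    exact (S.U_commute j l (by omega) a ha b hb).symm
  exact (Subgroup.mem_centralizer_iff.1 (h ha) b hb).symm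

theorem conj_mem_upper {h w : N.Gam} (hh : h ∈ N.edgeGroup) (hw : w ∈ S.upper i) :
    h * w * h⁻¹ ∈ S.upper i := by
  have : S.upper i ≤ (S.upper i).comap (MulAut.conj h).toMonoidHom := by
    refine iSup₂_le fun j hj u hu => ?_
    exact U_le_upper hj (S.U_invariant j (by omega) h hh u hu)
  exact this hw

theorem conj_mem_lower {h w : N.Gam} (hh : h ∈ N.edgeGroup) (hw : w ∈ S.lower i) :
    h * w * h⁻¹ ∈ S.lower i := by
  have : S.lower i ≤ (S.lower i).comap (MulAut.conj h).toMonoidHom := by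
    refine iSup₂_le fun j hj u hu => ?_
    refine U_le_lower hj ?_
    rcases j.eq_zero_or_pos with rfl | hj
    · rw [S.U_zero, Subgroup.mem_bot] at hu
      simp [hu]
    · exact S.U_invariant j hj h hh u hu
  exact this hw

/-- Every element of `Γᵢ` is a product of an element of `U₁ ⋯ Uᵢ` and one of `H₀`. -/
theorem exists_mul_of_mem_sup_lower {p : N.Gam} (hp : p ∈ N.edgeGroup ⊔ S.lower i) :
    ∃ v ∈ S.lower i, ∃ h ∈ N.edgeGroup, p = v * h :=
  Subgroup.exists_mul_of_mem_sup_of_conj_mem (fun _ hb _ hw => conj_mem_lower hb hw) hp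

theorem conj_mem_upper_of_mem_sup {p w : N.Gam} (hp : p ∈ N.edgeGroup ⊔ S.lower i)
    (hw : w ∈ S.upper i) : p * w * p⁻¹ ∈ S.upper i := by
  obtain ⟨v, hv, h, hh, rfl⟩ := exists_mul_of_mem_sup_lower hp
  have h1 := conj_mem_upper hh hw
  have h2 : v * h * w * (v * h)⁻¹ = v * (h * w * h⁻¹) * v⁻¹ := by group
  rw [h2, (commute_lower_upper hv h1).eq, mul_inv_cancel_right]
  exact h1

theorem rayGroup_le : N.rayGroup ≤ (N.edgeGroup ⊔ S.lower i) ⊔ S.upper i := by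
  refine iSup_le fun m => ?_
  rw [S.vertexGroup_eq m.succ_pos]
  refine sup_le (le_sup_left.trans le_sup_left) (iSup₂_le fun j _ => ?_)
  rcases le_or_gt j i with h | h
  · exact (U_le_lower h).trans (le_sup_right.trans le_sup_left)
  · exact (U_le_upper h).trans le_sup_right

theorem exists_mul_of_mem_rayGroup {p : N.Gam} (hp : p ∈ N.rayGroup) :
    ∃ w ∈ S.upper i, ∃ b ∈ N.edgeGroup ⊔ S.lower i, p = w * b :=
  Subgroup.exists_mul_of_mem_sup_of_conj_mem
    (fun _ hb _ hw => conj_mem_upper_of_mem_sup hb hw) (rayGroup_le hp)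

/-- Together with `exists_mul_of_mem_rayGroup` and `disjoint_upper` this makes `rayGroup` the
semidirect product of the normal subgroup `upper i` and `H₀ U₁ ⋯ Uᵢ`, which is `Γᵢ` for `i > 0` and
`H₀` for `i = 0`. -/
theorem conj_mem_upper_of_mem_rayGroup {p w : N.Gam} (hp : p ∈ N.rayGroup)
    (hw : w ∈ S.upper i) : p * w * p⁻¹ ∈ S.upper i := by
  obtain ⟨v, hv, b, hb, rfl⟩ := exists_mul_of_mem_rayGroup (S := S) (i := i) hp
  have h1 := conj_mem_upper_of_mem_sup hb hw
  have h2 : v * b * w * (v * b)⁻¹ = v * (b * w * b⁻¹) * v⁻¹ := by group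
  rw [h2]
  exact Subgroup.mul_mem _ (Subgroup.mul_mem _ hv h1) (Subgroup.inv_mem _ hv)

/-- A general form of independence: the groups generated by the `Uⱼ` with `j ≤ i` and with
`j ∈ t` are disjoint if `t` contains no `j ≤ i`. -/
theorem disjoint_lower_iSup (i : ℕ) (t : Set ℕ) (ht : ∀ j ∈ t, i < j) :
    Disjoint (S.lower i) (⨆ j ∈ t, S.U j) := by
  induction i with
  | zero =>
    have : S.lower 0 = ⊥ := by
      refine le_bot_iff.1 (iSup₂_le fun j hj => ?_)
      rw [Nat.le_zero.1 hj, S.U_zero]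
    rw [this]
    exact disjoint_bot_left
  | succ i ih =>
    rw [Subgroup.disjoint_def]
    intro v hv hv'
    have hle : S.lower (i + 1) ≤ S.lower i ⊔ S.U (i + 1) := by
      refine iSup₂_le fun j hj => ?_
      rcases Nat.le_succ_iff.1 hj with h | rfl
      · exact (U_le_lower h).trans le_sup_left
      · exact le_sup_right
    obtain ⟨u, hu, w, hw, rfl⟩ := Subgroup.exists_mul_of_mem_sup_of_conj_mem
      (W := S.U (i + 1)) (B := S.lower i) (fun b hb u hu => by
        rw [(commute_lower_upper hb (U_le_upper (lt_add_one i) hu)).eq, mul_inv_cancel_right]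
        exact hu) (hle hv)
    -- Both `u * w` and `w` lie in the span of the `Uⱼ` with `j ≠ i + 1`, so `u` does too, and
    -- independence applies.
    have h1 : u = 1 := by
      have hd := S.U_indep (i + 1)
      refine Subgroup.disjoint_def.1 hd hu ?_
      have : u = (u * w) * w⁻¹ := by group
      rw [this]
      refine Subgroup.mul_mem _ ?_ (Subgroup.inv_mem _ ?_)
      · refine (iSup₂_le fun j hj => ?_ : ⨆ j ∈ t, S.U j ≤ _) hv'
        exact le_iSup₂ (f := fun j (_ : j ≠ i + 1) => S.U j) j (ht j hj).ne'
      · refine (iSup₂_le fun j hj => ?_ : S.lower i ≤ _) hw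
        exact le_iSup₂ (f := fun j (_ : j ≠ i + 1) => S.U j) j (by omega)
    subst h1
    rw [one_mul] at hv' ⊢
    exact Subgroup.disjoint_def.1 (ih fun j hj => (lt_add_one i).trans (ht j hj)) hw hv'

theorem disjoint_lower_upper : Disjoint (S.lower i) (S.upper i) :=
  disjoint_lower_iSup i {j | i < j} fun _ => id

theorem disjoint_edgeGroup_iSup : Disjoint N.edgeGroup (⨆ j, S.U j) := by
  have hd : Directed (· ≤ ·) S.lower := by
    refine Monotone.directed_le fun i j hij => iSup₂_le fun m hm => ?_
    exact U_le_lower (hm.trans hij)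
  rw [Subgroup.disjoint_def]
  intro h hh hu
  have : ⨆ j, S.U j ≤ ⨆ j, S.lower j := iSup_mono fun j => U_le_lower le_rfl
  obtain ⟨m, hm⟩ := (Subgroup.mem_iSup_of_directed hd).1 (this hu)
  have hle : S.lower m ≤ S.lower (m + 1) := iSup₂_le fun j hj => U_le_lower (by omega)
  exact Subgroup.disjoint_def.1 (S.disjoint (m + 1) m.succ_pos) hh (hle hm)

theorem disjoint_upper : Disjoint (S.upper i) (N.edgeGroup ⊔ S.lower i) := by
  rw [Subgroup.disjoint_def]
  intro w hw hb
  obtain ⟨v, hv, h, hh, rfl⟩ := exists_mul_of_mem_sup_lower hb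
  have h1 : h = 1 := by
    refine Subgroup.disjoint_def.1 (disjoint_edgeGroup_iSup (S := S)) hh ?_
    have : h = v⁻¹ * (v * h) := by group
    rw [this]
    refine Subgroup.mul_mem _ (Subgroup.inv_mem _ ?_) ?_
    · exact (iSup₂_le fun j _ => le_iSup S.U j : S.lower i ≤ _) hv
    · exact (iSup₂_le fun j _ => le_iSup S.U j : S.upper i ≤ _) hw
  subst h1
  rw [mul_one] at hw ⊢
  exact Subgroup.disjoint_def.1 disjoint_lower_upper hv hw

variable (S i)

/-- The retraction of `Γ` onto the group generated by the vertex groups of level at most `i`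
which kills the groups `Uⱼ` for `j > i`. -/
theorem exists_retr : ∃ π : N.Gam →* N.Gam, (∀ z ∈ N.vertexGroup 0, π z = z) ∧
    (∀ b ∈ N.edgeGroup ⊔ S.lower i, π b = b) ∧ (∀ w ∈ S.upper i, π w = 1) := by
  obtain ⟨r, hr⟩ := Subgroup.exists_retraction (P := N.rayGroup) (W := S.upper i)
    (B := N.edgeGroup ⊔ S.lower i) (fun p hp => exists_mul_of_mem_rayGroup hp)
    (fun p hp w hw => conj_mem_upper_of_mem_rayGroup hp hw) disjoint_upper
  -- The inclusion of `Γ₀` and the projection `r` of the ray group are both the identity on `H₀`, so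
  -- they glue.
  obtain ⟨π, h₀, h⟩ := exists_Gam_hom_of_rayGroup (N.of 0) r fun x hx =>
    (hr ⟨_, hx⟩).2 1 (Subgroup.one_mem _) _ (Subgroup.mem_sup_left ⟨x, rfl⟩) (one_mul _).symm
  refine ⟨π, ?_, fun b hb => ?_, fun w hw => ?_⟩
  · rintro _ ⟨z, rfl⟩
    exact h₀ z
  · have hb' : b ∈ N.rayGroup := by
      refine (sup_le edgeGroup_le_rayGroup (iSup₂_le fun j _ => U_le_rayGroup j) :
        N.edgeGroup ⊔ S.lower i ≤ _) hb
    exact (h ⟨b, hb'⟩).trans ((hr _).2 1 (Subgroup.one_mem _) b hb (one_mul _).symm)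
  · exact (h ⟨w, upper_le_rayGroup hw⟩).trans
      ((hr _).2 w hw 1 (Subgroup.one_mem _) (mul_one _).symm)

/-- The retraction of `Γ` onto the group generated by the vertex groups of level at most `i`
which kills the groups `Uⱼ` for `j > i`. -/
noncomputable def retr : N.Gam →* N.Gam := (exists_retr S i).choose

variable {S i}

theorem retr_of_mem_zero {z : N.Gam} (hz : z ∈ N.vertexGroup 0) : S.retr i z = z :=
  (exists_retr S i).choose_spec.1 z hz

theorem retr_of_mem_sup {b : N.Gam} (hb : b ∈ N.edgeGroup ⊔ S.lower i) : S.retr i b = b :=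
  (exists_retr S i).choose_spec.2.1 b hb

theorem retr_of_mem_upper {w : N.Gam} (hw : w ∈ S.upper i) : S.retr i w = 1 :=
  (exists_retr S i).choose_spec.2.2 w hw

theorem vertexGroup_le_sup {m : ℕ} (hm : 0 < m) (h : m ≤ i) :
    N.vertexGroup m ≤ N.edgeGroup ⊔ S.lower i := by
  rw [S.vertexGroup_eq hm]
  exact sup_le_sup_left (iSup₂_le fun j hj => U_le_lower (hj.trans h)) _

theorem retr_of_mem_lowGroup {a : N.Gam} (ha : a ∈ N.lowGroup i) : S.retr i a = a := by
  have : N.lowGroup i ≤ (S.retr i).eqLocus (MonoidHom.id _) := by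
    refine iSup₂_le fun m hm => ?_
    rcases m.eq_zero_or_pos with rfl | h
    · exact fun z hz => retr_of_mem_zero hz
    · exact fun z hz => retr_of_mem_sup (vertexGroup_le_sup h hm hz)
  exact this ha

theorem sup_le_lowGroup : N.edgeGroup ⊔ S.lower i ≤ N.lowGroup i := by
  refine sup_le (edgeGroup_le_lowGroup i) (iSup₂_le fun j hj => ?_)
  rcases j.eq_zero_or_pos with rfl | h
  · rw [S.U_zero]; exact bot_le
  · exact (S.U_le j h).trans (vertexGroup_le_lowGroup hj)

theorem retr_mem_lowGroup (g : N.Gam) : S.retr i g ∈ N.lowGroup i := by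
  have : ⨆ m, N.vertexGroup m ≤ (N.lowGroup i).comap (S.retr i) := by
    refine iSup_le fun m p hp => ?_
    rw [Subgroup.mem_comap]
    rcases m.eq_zero_or_pos with rfl | h
    · rw [retr_of_mem_zero hp]
      exact vertexGroup_le_lowGroup (Nat.zero_le i) hp
    · obtain ⟨w, hw, b, hb, rfl⟩ := exists_mul_of_mem_rayGroup (S := S) (i := i)
        (vertexGroup_le_rayGroup h hp)
      rw [map_mul, retr_of_mem_upper hw, retr_of_mem_sup hb, one_mul]
      exact sup_le_lowGroup hb
  exact this (iSup_vertexGroup (N := N) ▸ Subgroup.mem_top g)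

theorem retr_retr (g : N.Gam) : S.retr i (S.retr i g) = S.retr i g :=
  retr_of_mem_lowGroup (retr_mem_lowGroup g)

variable (S i) in
/-- The kernel of the retraction, i.e. the normal closure of the `Uⱼ` with `j > i`. -/
noncomputable abbrev kern : Subgroup N.Gam := (S.retr i).ker

theorem upper_le_kern : S.upper i ≤ S.kern i := fun _ hw => retr_of_mem_upper hw

theorem eq_one_of_mem_kern_of_mem_lowGroup {g : N.Gam} (h : g ∈ S.kern i)
    (h' : g ∈ N.lowGroup i) : g = 1 :=
  (retr_of_mem_lowGroup h').symm.trans h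

theorem mul_retr_inv_mem_kern (g : N.Gam) : g * (S.retr i g)⁻¹ ∈ S.kern i := by
  rw [MonoidHom.mem_ker, map_mul, map_inv, retr_retr, mul_inv_cancel]

theorem conj_mem_kern {g κ : N.Gam} (h : κ ∈ S.kern i) : g * κ * g⁻¹ ∈ S.kern i :=
  (inferInstance : (S.kern i).Normal).conj_mem κ h g

variable (S i) in
/-- Generators for the kernel of the retraction. -/
theorem kern_eq_closure : S.kern i =
    Subgroup.closure {g | ∃ a ∈ N.lowGroup i, ∃ w ∈ S.upper i, g = a * w * a⁻¹} := by
  set K' := Subgroup.closure {g | ∃ a ∈ N.lowGroup i, ∃ w ∈ S.upper i, g = a * w * a⁻¹}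
  have hK : K' ≤ S.kern i := by
    refine (Subgroup.closure_le _).2 ?_
    rintro _ ⟨a, -, w, hw, rfl⟩
    exact conj_mem_kern (upper_le_kern hw)
  refine le_antisymm (fun g hg => ?_) hK
  have hn : ∀ b ∈ N.lowGroup i, ∀ κ ∈ K', b * κ * b⁻¹ ∈ K' := by
    intro b hb
    have : K' ≤ K'.comap (MulAut.conj b).toMonoidHom := by
      refine (Subgroup.closure_le _).2 ?_
      rintro _ ⟨a, ha, w, hw, rfl⟩
      exact Subgroup.subset_closure ⟨b * a, Subgroup.mul_mem _ hb ha, w, hw, by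
        simp only [MulEquiv.toMonoidHom_eq_coe, MonoidHom.coe_coe, MulAut.conj_apply]; group⟩
    exact fun κ hκ => this hκ
  -- `K'` is normalized by `lowGroup i` and the two generate `Γ`. As `lowGroup i` meets the kernel
  -- trivially, `K'` is already the whole kernel.
  have htop : ⨆ m, N.vertexGroup m ≤ N.lowGroup i ⊔ K' := by
    refine iSup_le fun m p hp => ?_
    rcases m.eq_zero_or_pos with rfl | h
    · exact Subgroup.mem_sup_left (vertexGroup_le_lowGroup (Nat.zero_le i) hp)
    · obtain ⟨w, hw, b, hb, rfl⟩ := exists_mul_of_mem_rayGroup (S := S) (i := i)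
        (vertexGroup_le_rayGroup h hp)
      exact Subgroup.mul_mem _ (Subgroup.mem_sup_right (Subgroup.subset_closure
        ⟨1, Subgroup.one_mem _, w, hw, by simp⟩)) (Subgroup.mem_sup_left (sup_le_lowGroup hb))
  obtain ⟨κ, hκ, b, hb, rfl⟩ := Subgroup.exists_mul_of_mem_sup_of_conj_mem hn
    (htop (iSup_vertexGroup (N := N) ▸ Subgroup.mem_top g))
  have hb1 : b = 1 := by
    have := eq_one_of_mem_kern_of_mem_lowGroup (S := S) (i := i) (g := b) ?_ hb
    · exact this
    · have := Subgroup.mul_mem _ (Subgroup.inv_mem _ (hK hκ)) hg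
      rwa [inv_mul_cancel_left] at this
  rw [hb1, mul_one]
  exact hκ

end DirectSplitting

end NagaoRay

/-! ### Free actions on `ℕ` and the embedding of `Γ₀` in `Γ`. -/

theorem exists_free_action {B : Type*} [Group B] (e : ℕ ≃ B × ℕ) :
    ∃ β : B →* Equiv.Perm ℕ, ∀ b n, e (β b n) = (b * (e n).1, (e n).2) := by
  refine ⟨MonoidHom.mk' (fun b => (e.trans
    ((Equiv.mulLeft b).prodCongr (Equiv.refl ℕ))).trans e.symm) fun b b' => ?_, fun b n => ?_⟩
  · ext n
    simp [Equiv.Perm.mul_apply, Prod.map]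
  · simp [Prod.map]

/-- A free action of a group on `ℕ` with infinitely many orbits extends to such an action of any
finite overgroup. -/
theorem exists_free_action_extension {A B : Type*} [Group A] [Group B] [Finite B] (ι : A →* B)
    (hι : Function.Injective ι) (α : A →* Equiv.Perm ℕ) (e : ℕ ≃ A × ℕ)
    (he : ∀ a n, e (α a n) = (a * (e n).1, (e n).2)) :
    ∃ β : B →* Equiv.Perm ℕ, (∃ e' : ℕ ≃ B × ℕ, ∀ b n, e' (β b n) = (b * (e' n).1, (e' n).2)) ∧
      ∀ a, β (ι a) = α a := by
  -- Inverses of left coset representatives form a right transversal, so `f` identifies `B` with `A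
  -- × B/A` compatibly with left multiplication by `A`.
  let f : A × (B ⧸ ι.range) → B := fun p => ι p.1 * (p.2.out)⁻¹
  have hmk : ∀ a q, (((f (a, q))⁻¹ : B) : B ⧸ ι.range) = q := by
    intro a q
    have : (f (a, q))⁻¹ = q.out * ι a⁻¹ := by simp [f]
    rw [this, QuotientGroup.mk_mul_of_mem _ (MonoidHom.mem_range.2 ⟨a⁻¹, rfl⟩),
      QuotientGroup.out_eq']
  have hf : Function.Bijective f := by
    constructor
    · rintro ⟨a, q⟩ ⟨a', q'⟩ h
      have hq : q = q' := by rw [← hmk a q, ← hmk a' q', h]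
      subst hq
      exact congrArg (·, q) (hι (mul_right_cancel h))
    · intro b
      have h : (((b⁻¹ : B) : B ⧸ ι.range).out)⁻¹ * b⁻¹ ∈ ι.range := by
        rw [← QuotientGroup.eq, QuotientGroup.out_eq']
      obtain ⟨a, ha⟩ := h
      refine ⟨(a⁻¹, ((b⁻¹ : B) : B ⧸ ι.range)), ?_⟩
      simp only [f, map_inv, ha]
      group
  obtain ⟨k⟩ : Nonempty (ℕ ≃ (B ⧸ ι.range) × ℕ) := nonempty_equiv_of_countable
  let d : B ≃ A × (B ⧸ ι.range) := (Equiv.ofBijective f hf).symm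
  -- The infinitely many `A`-orbits are grouped into `B`-orbits: `ℕ ≃ A × ℕ ≃ A × (B/A × ℕ) ≃ B ×
  -- ℕ`.
  let e' : ℕ ≃ B × ℕ := (e.trans ((Equiv.refl A).prodCongr k)).trans
    ((Equiv.prodAssoc _ _ _).symm.trans (d.symm.prodCongr (Equiv.refl ℕ)))
  have he' : ∀ n, e' n = (f ((e n).1, (k (e n).2).1), (k (e n).2).2) := fun n => rfl
  obtain ⟨β, hβ⟩ := exists_free_action e'
  refine ⟨β, ⟨e', hβ⟩, fun a => ?_⟩
  ext n
  apply e'.injective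
  rw [hβ, he', he', he]
  simp [f, mul_assoc]

namespace NagaoRay

variable {N : NagaoRay.{u}}

/-- A free action of `H₀` on `ℕ` is extended to free actions of `Γ₀` and, one after the other, of
`Γ₁, Γ₂, …`. These agree on the edge groups, so `Γ` acts on `ℕ` and its restriction to `Γ₀` is
faithful. -/
theorem of_zero_injective : Function.Injective (N.of 0) := by
  have : Finite N.H := Finite.of_injective _ N.inc₀_injective
  obtain ⟨e⟩ : Nonempty (ℕ ≃ N.H × ℕ) := nonempty_equiv_of_countable
  obtain ⟨α, hα⟩ := exists_free_action e
  obtain ⟨β₀, ⟨e₀, he₀⟩, hβ₀⟩ := exists_free_action_extension N.inc₀ N.inc₀_injective α e hα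
  obtain ⟨β₁, h₁, hβ₁⟩ := exists_free_action_extension N.inc₁ N.inc₁_injective α e hα
  let T : ℕ → Type u := fun m => {f : N.G (m + 1) →* Equiv.Perm ℕ //
    ∃ e : ℕ ≃ N.G (m + 1) × ℕ, ∀ b n, e (f b n) = (b * (e n).1, (e n).2)}
  have step : ∀ m (f : T m), ∃ f' : T (m + 1), ∀ a, f'.1 (N.inc m a) = f.1 a := by
    rintro m ⟨f, e, he⟩
    obtain ⟨β, h, hβ⟩ := exists_free_action_extension (N.inc m) (N.inc_injective m) f e he
    exact ⟨⟨β, h⟩, hβ⟩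
  choose next hnext using step
  let t : ∀ m, T m := fun m => Nat.rec ⟨β₁, h₁⟩ next m
  let f : ∀ m, N.G m →* Equiv.Perm ℕ := fun m => match m with
    | 0 => β₀
    | m + 1 => (t m).1
  obtain ⟨Φ, hΦ⟩ := exists_Gam_hom f (fun x => (hβ₀ x).trans (hβ₁ x).symm)
    (fun m g => (hnext m (t m) g).symm)
  refine (injective_iff_map_eq_one _).2 fun z hz => ?_
  have h1 : β₀ z = 1 := by rw [← map_one Φ, ← hz]; exact (hΦ 0 z).symm
  have h2 := he₀ z 0
  rw [h1] at h2
  have h3 := congrArg Prod.fst h2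
  simpa using h3

theorem mem_range_inc₀ {z : N.G 0} (hz : N.of 0 z ∈ N.edgeGroup) : z ∈ N.inc₀.range := by
  obtain ⟨h, hh⟩ := hz
  exact ⟨h, of_zero_injective hh⟩

/-! ### Vertices and the action of `Γ` on them -/

theorem smul_mk (g : N.Gam) (m : ℕ) (q : N.Gam ⧸ N.vertexGroup m) :
    g • (⟨m, q⟩ : N.Vertex) = ⟨m, g • q⟩ := rfl

theorem smul_baseVertex (g : N.Gam) (m : ℕ) :
    g • N.baseVertex m = ⟨m, (g : N.Gam ⧸ N.vertexGroup m)⟩ := by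
  rw [baseVertex, smul_mk, MulAction.Quotient.smul_mk, smul_eq_mul, mul_one]

theorem exists_eq_smul_baseVertex (v : N.Vertex) : ∃ g : N.Gam, v = g • N.baseVertex (level v) := by
  obtain ⟨m, q⟩ := v
  obtain ⟨g, rfl⟩ := QuotientGroup.mk_surjective q
  exact ⟨g, (smul_baseVertex g m).symm⟩

@[simp]
theorem level_smul (g : N.Gam) (v : N.Vertex) : level (g • v) = level v := rfl

@[simp]
theorem level_baseVertex (m : ℕ) : level (N.baseVertex m) = m := rfl

theorem smul_baseVertex_eq_iff {g g' : N.Gam} {m : ℕ} :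
    g • N.baseVertex m = g' • N.baseVertex m ↔ g⁻¹ * g' ∈ N.vertexGroup m := by
  rw [smul_baseVertex, smul_baseVertex, ← QuotientGroup.eq]
  constructor
  · intro h
    exact eq_of_heq (Sigma.mk.inj h).2
  · intro h
    rw [h]

theorem smul_baseVertex_of_mem {c : N.Gam} {m : ℕ} (hc : c ∈ N.vertexGroup m) :
    c • N.baseVertex m = N.baseVertex m := by
  conv_rhs => rw [← one_smul N.Gam (N.baseVertex m)]
  rw [smul_baseVertex_eq_iff, mul_one]
  exact Subgroup.inv_mem _ hc

/-! ### Homomorphisms on the kernel with prescribed conjugations. -/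

namespace DirectSplitting

variable {S : N.DirectSplitting} {i : ℕ}

open RegularWreathProduct in
/-- For every function `c` on the vertices there is a homomorphism on the kernel of the retraction
that conjugates the stabilizer of the horoball at `a xᵢ` by `c (a xᵢ)`. -/
theorem exists_twist (S : N.DirectSplitting) (hi : 0 < i) (c : N.Vertex → N.Gam) :
    ∃ φ : S.kern i →* N.Gam, ∀ a ∈ N.lowGroup i, ∀ w ∈ S.upper i,
      ∀ h : a * w * a⁻¹ ∈ S.kern i, φ ⟨_, h⟩ =
        c (a • N.baseVertex i) * (a * w * a⁻¹) * (c (a • N.baseVertex i))⁻¹ := by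
  let θ : N.Gam → N.Gam := fun x => c (x⁻¹ • N.baseVertex i) * x⁻¹
  have hθ : ∀ b ∈ N.vertexGroup i, ∀ x, (θ x)⁻¹ * θ (b⁻¹ * x) = b := by
    intro b hb x
    have : (b⁻¹ * x)⁻¹ • N.baseVertex i = x⁻¹ • N.baseVertex i := by
      rw [mul_inv_rev, inv_inv, mul_smul, smul_baseVertex_of_mem hb]
    simp only [θ, this]
    group
  -- `Θ` is the embedding `z ↦ (1, z)` conjugated by the function `θ`. By `hθ` its function part is
  -- the constant `b` for `b ∈ Γᵢ`, so it agrees there with `F`. Hence `Θ` on `Γ₀` and `F` on the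
  -- ray group glue to `Φ`.
  let Θ : N.Gam →* RegularWreathProduct N.Gam N.Gam := MonoidHom.mk'
    (fun z => ⟨fun x => (θ x)⁻¹ * θ (z⁻¹ * x), z⟩) (by
      intro z z'
      ext x
      · simp [mul_assoc]
      · rfl)
  let F : N.Gam →* RegularWreathProduct N.Gam N.Gam := MonoidHom.mk'
    (fun u => ⟨fun _ => u, S.retr i u⟩) (by
      intro z z'
      ext x
      · rfl
      · exact map_mul _ _ _)
  have hΘF : ∀ b ∈ N.vertexGroup i, F b = Θ b := by
    intro b hb
    ext x
    · exact (hθ b hb x).symm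
    · exact retr_of_mem_sup (vertexGroup_le_sup hi le_rfl hb)
  obtain ⟨Φ, hΦ₀, hΦ⟩ := exists_Gam_hom_of_rayGroup (Θ.comp (N.of 0)) (F.comp N.rayGroup.subtype)
    fun x hx => hΘF _ (edgeGroup_le hi ⟨x, rfl⟩)
  have hlow : N.lowGroup i ≤ Φ.eqLocus Θ := by
    refine iSup₂_le fun m hm => ?_
    rcases m.eq_zero_or_pos with rfl | h
    · rintro _ ⟨z, rfl⟩
      exact hΦ₀ z
    · intro b hb
      exact (hΦ ⟨b, vertexGroup_le_rayGroup h hb⟩).trans (hΘF b (vertexGroup_mono h hm hb))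
  have hright : (rightHom : RegularWreathProduct N.Gam N.Gam →* N.Gam).comp Φ = S.retr i := by
    refine Gam_hom_ext ?_ ?_
    · rintro _ ⟨z, rfl⟩
      rw [retr_of_mem_zero ⟨z, rfl⟩, MonoidHom.comp_apply, hΦ₀]
      rfl
    · intro p hp
      rw [MonoidHom.comp_apply, hΦ ⟨p, hp⟩]
      rfl
  have hker : ∀ κ : S.kern i, (Φ κ).right = 1 := fun κ =>
    (DFunLike.congr_fun hright (κ : N.Gam)).trans κ.2
  -- On the kernel the permutation part of `Φ` is trivial, so evaluation at `1` is multiplicative.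
  -- On `a w a⁻¹` it yields the conjugate of `w` by `(θ 1)⁻¹ θ(a⁻¹)`, where `θ(a⁻¹) = c (a xᵢ) a`;
  -- the outer `θ 1` cancels the first factor.
  refine ⟨MonoidHom.mk' (fun κ => θ 1 * (Φ κ).left 1 * (θ 1)⁻¹) ?_, ?_⟩
  · intro κ κ'
    simp [hker κ]
  · intro a ha w hw h
    have h1 : Φ (a * w * a⁻¹) = Θ a * F w * Θ a⁻¹ := by
      rw [map_mul, map_mul, hlow ha, hlow (Subgroup.inv_mem _ ha)]
      congr 2
      exact hΦ ⟨w, upper_le_rayGroup hw⟩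
    change θ 1 * (Φ (a * w * a⁻¹)).left 1 * (θ 1)⁻¹ = _
    rw [h1]
    simp [Θ, F, θ, retr_of_mem_upper hw, mul_assoc]

end DirectSplitting

/-! ### The tree and the action of `Γ` on it. -/

variable {N : NagaoRay.{u}} {i : ℕ}

theorem tree_adj_iff {v w : N.Vertex} : N.tree.Adj v w ↔ ∃ (g : N.Gam) (m : ℕ),
    (v = g • N.baseVertex m ∧ w = g • N.baseVertex (m + 1)) ∨
    (w = g • N.baseVertex m ∧ v = g • N.baseVertex (m + 1)) := by
  rw [tree, SimpleGraph.fromRel_adj]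
  constructor
  · rintro ⟨-, ⟨g, m, h⟩ | ⟨g, m, h⟩⟩
    · exact ⟨g, m, Or.inl h⟩
    · exact ⟨g, m, Or.inr h⟩
  · rintro ⟨g, m, h⟩
    refine ⟨?_, ?_⟩
    · rintro rfl
      rcases h with ⟨h, h'⟩ | ⟨h, h'⟩ <;>
      · have h1 := congrArg level h
        have h2 := congrArg level h'
        simp only [level_smul, level_baseVertex] at h1 h2
        omega
    · rcases h with h | h
      · exact Or.inl ⟨g, m, h⟩
      · exact Or.inr ⟨g, m, h⟩

theorem tree_adj_smul_baseVertex (g : N.Gam) (m : ℕ) :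
    N.tree.Adj (g • N.baseVertex m) (g • N.baseVertex (m + 1)) :=
  tree_adj_iff.2 ⟨g, m, Or.inl ⟨rfl, rfl⟩⟩

theorem tree_adj_smul {v w : N.Vertex} (g : N.Gam) (h : N.tree.Adj v w) :
    N.tree.Adj (g • v) (g • w) := by
  obtain ⟨k, m, ⟨rfl, rfl⟩ | ⟨rfl, rfl⟩⟩ := tree_adj_iff.1 h
  · exact tree_adj_iff.2 ⟨g * k, m, Or.inl ⟨smul_smul _ _ _, smul_smul _ _ _⟩⟩
  · exact tree_adj_iff.2 ⟨g * k, m, Or.inr ⟨smul_smul _ _ _, smul_smul _ _ _⟩⟩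

/-- The action of an element of `Γ` as an automorphism of the tree. -/
def smulIso (g : N.Gam) : N.AutT where
  toEquiv := MulAction.toPerm g
  map_rel_iff' := by
    intro v w
    refine ⟨fun h => ?_, tree_adj_smul g⟩
    have := tree_adj_smul g⁻¹ h
    simpa using this

@[simp]
theorem smulIso_apply (g : N.Gam) (v : N.Vertex) : smulIso g v = g • v := rfl

theorem levelPreserving_smulIso (g : N.Gam) : LevelPreserving (smulIso g) := fun v => level_smul g v

/-! ### The components of bounded level -/

/-- Two vertices lie in the same component of the forest of vertices of level at most `i`. -/
def LowReachable (i : ℕ) (v w : N.Vertex) : Prop :=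
  ∃ (hv : level v ≤ i) (hw : level w ≤ i), (N.forest i).Reachable ⟨v, hv⟩ ⟨w, hw⟩

namespace LowReachable

theorem refl {v : N.Vertex} (hv : level v ≤ i) : LowReachable i v v := ⟨hv, hv, .refl _⟩

theorem symm {v w : N.Vertex} (h : LowReachable i v w) : LowReachable i w v := by
  obtain ⟨hv, hw, h⟩ := h
  exact ⟨hw, hv, h.symm⟩

theorem trans {v w z : N.Vertex} (h : LowReachable i v w) (h' : LowReachable i w z) :
    LowReachable i v z := by
  obtain ⟨hv, hw, h⟩ := h
  obtain ⟨hw', hz, h'⟩ := h'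
  exact ⟨hv, hz, h.trans h'⟩

theorem smul {v w : N.Vertex} (g : N.Gam) (h : LowReachable i v w) :
    LowReachable i (g • v) (g • w) := by
  obtain ⟨hv, hw, h⟩ := h
  exact ⟨hv, hw, h.map (forestIso (smulIso g) (levelPreserving_smulIso g) i).toHom⟩

theorem reachable {v w : N.Vertex} (h : LowReachable i v w) : N.tree.Reachable v w := by
  obtain ⟨hv, hw, h⟩ := h
  exact h.map (SimpleGraph.Embedding.induce _).toHom

theorem of_mem_lowGroup {a : N.Gam} (ha : a ∈ N.lowGroup i) {m : ℕ} (hm : m ≤ i) :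
    LowReachable i (N.baseVertex 0) (a • N.baseVertex m) := by
  have hbase : ∀ m ≤ i, LowReachable i (N.baseVertex 0) (N.baseVertex m) := by
    intro m hm
    induction m with
    | zero => exact .refl (Nat.zero_le i)
    | succ m ih =>
      refine (ih (by omega)).trans ⟨by rw [level_baseVertex]; omega, hm,
        SimpleGraph.Adj.reachable ?_⟩
      have := tree_adj_smul_baseVertex (1 : N.Gam) m
      rw [one_smul, one_smul] at this
      exact this
  let K : Subgroup N.Gam :=
    { carrier := {g | LowReachable i (N.baseVertex 0) (g • N.baseVertex 0)}
      one_mem' := by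
        rw [Set.mem_ofPred_eq, one_smul]
        exact .refl (Nat.zero_le i)
      mul_mem' := by
        intro g h hg hh
        rw [Set.mem_ofPred_eq, mul_smul]
        exact hg.trans (hh.smul g)
      inv_mem' := by
        intro g hg
        have := hg.symm.smul g⁻¹
        rwa [inv_smul_smul] at this }
  have hK : N.lowGroup i ≤ K := by
    refine iSup₂_le fun m hm c hc => ?_
    have := (hbase m hm).symm.smul c
    rw [smul_baseVertex_of_mem hc] at this
    exact (hbase m hm).trans this
  exact (hK ha).trans ((hbase m hm).smul a)

end LowReachable

theorem tree_preconnected : N.tree.Preconnected := by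
  have : ∀ v, N.tree.Reachable (N.baseVertex 0) v := by
    intro v
    obtain ⟨g, hv⟩ := exists_eq_smul_baseVertex v
    obtain ⟨j, hj⟩ := exists_mem_lowGroup g
    have hj' : g ∈ N.lowGroup (max j (level v)) := by
      refine (iSup₂_le fun m hm => ?_ : N.lowGroup j ≤ _) hj
      exact vertexGroup_le_lowGroup (hm.trans (le_max_left _ _))
    rw [hv]
    exact (LowReachable.of_mem_lowGroup hj' (le_max_right _ _)).reachable
  exact fun v w => (this v).symm.trans (this w)

variable (N) in
/-- The `κ`-translate of the component of the vertex `x₀`. -/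
def cell (i : ℕ) (κ : N.Gam) : Set N.Vertex :=
  {v | ∃ a ∈ N.lowGroup i, ∃ m ≤ i, v = (κ * a) • N.baseVertex m}

theorem smul_mem_cell {κ : N.Gam} {v : N.Vertex} (g : N.Gam) (h : v ∈ N.cell i κ) :
    g • v ∈ N.cell i (g * κ) := by
  obtain ⟨a, ha, m, hm, rfl⟩ := h
  exact ⟨a, ha, m, hm, by rw [smul_smul, mul_assoc]⟩

theorem smul_mem_cell_iff {κ g : N.Gam} {v : N.Vertex} :
    g • v ∈ N.cell i κ ↔ v ∈ N.cell i (g⁻¹ * κ) := by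
  constructor
  · intro h
    have := smul_mem_cell g⁻¹ h
    rwa [inv_smul_smul] at this
  · intro h
    have := smul_mem_cell g h
    rwa [mul_inv_cancel_left] at this

theorem baseVertex_mem_cell {m : ℕ} (hm : m ≤ i) : N.baseVertex m ∈ N.cell i 1 :=
  ⟨1, Subgroup.one_mem _, m, hm, by rw [mul_one, one_smul]⟩

/-- Two names of a vertex of level `m ≤ i` differ by an element of `Γₘ`, which `lowGroup i` absorbs.
So walks of level at most `i` never leave a cell. -/
theorem mem_cell_of_adj {κ : N.Gam} {v w : N.Vertex} (hv : v ∈ N.cell i κ)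
    (hw : level w ≤ i) (h : N.tree.Adj v w) : w ∈ N.cell i κ := by
  obtain ⟨a, ha, m, hm, rfl⟩ := hv
  have key : ∀ (g : N.Gam) (l l' : ℕ), l' ≤ i → (κ * a) • N.baseVertex m = g • N.baseVertex l →
      g • N.baseVertex l' ∈ N.cell i κ := by
    intro g l l' hl' h
    obtain rfl : m = l := congrArg level h
    rw [smul_baseVertex_eq_iff] at h
    refine ⟨a * ((κ * a)⁻¹ * g), Subgroup.mul_mem _ ha (vertexGroup_le_lowGroup hm h), l', hl', ?_⟩
    congr 1
    group
  obtain ⟨g, l, ⟨e, rfl⟩ | ⟨rfl, e⟩⟩ := tree_adj_iff.1 h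
  · exact key g l _ hw e
  · exact key g (l + 1) _ hw e

theorem LowReachable.mem_cell {κ : N.Gam} {v w : N.Vertex} (h : LowReachable i v w)
    (hv : v ∈ N.cell i κ) : w ∈ N.cell i κ := by
  obtain ⟨hv', hw', ⟨p⟩⟩ := h
  have : ∀ {a b : {v : N.Vertex | level v ≤ i}} (p : (N.forest i).Walk a b),
      a.1 ∈ N.cell i κ → b.1 ∈ N.cell i κ := by
    intro a b p
    induction p with
    | nil => exact id
    | @cons a c b h p ih => exact fun ha => ih (mem_cell_of_adj ha c.2 h)
  exact this p hv

theorem lowReachable_iff_mem_cell {κ : N.Gam} {v w : N.Vertex} (hv : v ∈ N.cell i κ) :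
    LowReachable i v w ↔ w ∈ N.cell i κ := by
  refine ⟨fun h => h.mem_cell hv, fun hw => ?_⟩
  have : ∀ v ∈ N.cell i κ, LowReachable i (κ • N.baseVertex 0) v := by
    rintro _ ⟨a, ha, m, hm, rfl⟩
    rw [mul_smul]
    exact (LowReachable.of_mem_lowGroup ha hm).smul κ
  exact (this v hv).symm.trans (this w hw)

namespace DirectSplitting

variable {S : N.DirectSplitting}

theorem smul_baseVertex_mem_cell (g : N.Gam) {m : ℕ} (hm : m ≤ i) :
    g • N.baseVertex m ∈ N.cell i (g * (S.retr i g)⁻¹) :=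
  ⟨S.retr i g, retr_mem_lowGroup g, m, hm, by rw [inv_mul_cancel_right]⟩

theorem exists_mem_cell (S : N.DirectSplitting) {v : N.Vertex} (hv : level v ≤ i) :
    ∃ κ ∈ S.kern i, v ∈ N.cell i κ := by
  obtain ⟨g, hg⟩ := exists_eq_smul_baseVertex v
  rw [hg]
  exact ⟨_, mul_retr_inv_mem_kern g, smul_baseVertex_mem_cell g hv⟩

/-- A common vertex forces `κ⁻¹ κ'` into `lowGroup i`, which meets the kernel trivially. This is the
freeness of the kernel's action on the components. -/
theorem eq_of_mem_cell {κ κ' : N.Gam} (hκ : κ ∈ S.kern i) (hκ' : κ' ∈ S.kern i)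
    {v : N.Vertex} (h : v ∈ N.cell i κ) (h' : v ∈ N.cell i κ') : κ = κ' := by
  obtain ⟨a, ha, m, hm, rfl⟩ := h
  obtain ⟨a', ha', m', hm', h⟩ := h'
  obtain rfl : m = m' := congrArg level h
  rw [smul_baseVertex_eq_iff] at h
  have h1 := Subgroup.mul_mem _ (Subgroup.mul_mem _ ha (vertexGroup_le_lowGroup hm h))
    (Subgroup.inv_mem _ ha')
  have h2 : a * ((κ * a)⁻¹ * (κ' * a')) * a'⁻¹ = κ⁻¹ * κ' := by group
  rw [h2] at h1
  exact inv_mul_eq_one.1 (eq_one_of_mem_kern_of_mem_lowGroup (S := S)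
    (Subgroup.mul_mem _ (Subgroup.inv_mem _ hκ) hκ') h1)

theorem mem_components_iff (S : N.DirectSplitting) {X : Set N.Vertex} :
    X ∈ N.components i ↔ ∃ κ ∈ S.kern i, X = N.cell i κ := by
  have key : ∀ (v : {v : N.Vertex | level v ≤ i}) (κ : N.Gam), v.1 ∈ N.cell i κ →
      Subtype.val '' ((N.forest i).connectedComponentMk v).supp = N.cell i κ := by
    intro v κ hv
    ext w
    rw [← lowReachable_iff_mem_cell hv]
    simp only [Set.mem_image, SimpleGraph.ConnectedComponent.mem_supp_iff,
      SimpleGraph.ConnectedComponent.eq]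
    constructor
    · rintro ⟨w, hw, rfl⟩
      exact ⟨v.2, w.2, hw.symm⟩
    · rintro ⟨_, hw, h⟩
      exact ⟨⟨w, hw⟩, h.symm, rfl⟩
  constructor
  · rintro ⟨c, rfl⟩
    induction c using SimpleGraph.ConnectedComponent.ind with
    | h v =>
      obtain ⟨κ, hκ, hv⟩ := S.exists_mem_cell v.2
      exact ⟨κ, hκ, key v κ hv⟩
  · rintro ⟨κ, hκ, rfl⟩
    have h0 : κ • N.baseVertex 0 ∈ N.cell i κ := by
      have := smul_mem_cell κ (baseVertex_mem_cell (N := N) (Nat.zero_le i))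
      rwa [mul_one] at this
    exact ⟨(N.forest i).connectedComponentMk ⟨κ • N.baseVertex 0, Nat.zero_le i⟩, key _ κ h0⟩

variable (S) in
/-- The component of bounded level corresponding to an element of the kernel. -/
def comp (κ : S.kern i) : N.components i :=
  ⟨N.cell i κ, (mem_components_iff S).2 ⟨κ, κ.2, rfl⟩⟩

theorem exists_eq_comp (X : N.components i) : ∃ κ : S.kern i, X = S.comp κ := by
  obtain ⟨κ, hκ, h⟩ := (mem_components_iff S).1 X.2
  exact ⟨⟨κ, hκ⟩, Subtype.ext h⟩

theorem eq_comp_of_mem {X : N.components i} {κ : S.kern i} {v : N.Vertex} (hv : v ∈ X.1)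
    (hv' : v ∈ N.cell i κ) : X = S.comp κ := by
  obtain ⟨κ', rfl⟩ := exists_eq_comp (S := S) X
  rw [Subtype.ext (eq_of_mem_cell κ'.2 κ.2 hv hv')]

end DirectSplitting

theorem components_eq_of_mem (S : N.DirectSplitting) {X Y : N.components i} {v : N.Vertex}
    (hX : v ∈ X.1) (hY : v ∈ Y.1) : X = Y := by
  obtain ⟨κ, rfl⟩ := DirectSplitting.exists_eq_comp (S := S) Y
  exact DirectSplitting.eq_comp_of_mem hX hY

/-! ### Horospheres and horoballs -/

theorem dist_map_le (h : N.AutT) (v w : N.Vertex) :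
    N.tree.dist (h v) (h w) ≤ N.tree.dist v w := by
  obtain ⟨p, hp⟩ := (tree_preconnected v w).exists_walk_length_eq_dist
  rw [← hp, ← SimpleGraph.Walk.length_map h.toHom p]
  exact SimpleGraph.dist_le _

theorem dist_map (h : N.AutT) (v w : N.Vertex) :
    N.tree.dist (h v) (h w) = N.tree.dist v w := by
  refine le_antisymm (dist_map_le h v w) ?_
  have := dist_map_le h.symm (h v) (h w)
  rwa [h.symm_apply_apply, h.symm_apply_apply] at this

theorem IsLevelRay.map {h : N.AutT} (hl : LevelPreserving h) {x : N.Vertex} {r : ℕ → N.Vertex}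
    (hr : IsLevelRay x r) : IsLevelRay (h x) fun n => h (r n) := by
  obtain ⟨h0, h1, h2⟩ := hr
  refine ⟨congrArg h h0, fun n => h.map_adj_iff.2 (h1 n), fun n => ?_⟩
  rw [hl, hl, h2]

theorem map_mem_HB {h : N.AutT} (hl : LevelPreserving h) {x v : N.Vertex} (hv : v ∈ HB x) :
    h v ∈ HB (h x) := by
  obtain ⟨r, hr, hd⟩ := hv
  exact ⟨_, hr.map hl, hd.mono fun n hn => (dist_map h v (r n)).le.trans hn⟩

theorem map_mem_HS {h : N.AutT} (hl : LevelPreserving h) {x v : N.Vertex} (hv : v ∈ HS x) :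
    h v ∈ HS (h x) := by
  obtain ⟨r, hr, hd⟩ := hv
  exact ⟨_, hr.map hl, hd.mono fun n hn => (dist_map h v (r n)).trans hn⟩

theorem smul_mem_HB (g : N.Gam) {x v : N.Vertex} (hv : v ∈ HB x) : g • v ∈ HB (g • x) :=
  map_mem_HB (levelPreserving_smulIso g) hv

theorem smul_mem_HS (g : N.Gam) {x v : N.Vertex} (hv : v ∈ HS x) : g • v ∈ HS (g • x) :=
  map_mem_HS (levelPreserving_smulIso g) hv

theorem HS_subset_HB (x : N.Vertex) : HS x ⊆ HB x := by
  rintro v ⟨r, hr, hd⟩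
  exact ⟨r, hr, hd.mono fun n hn => hn.le⟩

theorem smul_baseVertex_add_eq {g g' : N.Gam} {m : ℕ} (hm : 0 < m) (l : ℕ)
    (h : g • N.baseVertex m = g' • N.baseVertex m) :
    g • N.baseVertex (m + l) = g' • N.baseVertex (m + l) := by
  rw [smul_baseVertex_eq_iff] at h ⊢
  exact vertexGroup_mono hm (Nat.le_add_right m l) h

theorem isLevelRay_baseVertex (i : ℕ) :
    IsLevelRay (N.baseVertex i) fun n => N.baseVertex (i + n) := by
  refine ⟨rfl, fun n => ?_, fun n => rfl⟩
  have := tree_adj_smul_baseVertex (1 : N.Gam) (i + n)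
  rwa [one_smul, one_smul] at this

theorem IsLevelRay.eq_baseVertex (hi : 0 < i) {r : ℕ → N.Vertex}
    (hr : IsLevelRay (N.baseVertex i) r) (n : ℕ) : r n = N.baseVertex (i + n) := by
  obtain ⟨h0, h1, h2⟩ := hr
  induction n with
  | zero => exact h0
  | succ n ih =>
    have hl := h2 (n + 1)
    obtain ⟨g, m, ⟨h, h'⟩ | ⟨h, h'⟩⟩ := tree_adj_iff.1 (h1 n)
    · rw [ih] at h
      obtain rfl : i + n = m := congrArg level h
      rw [h', ← add_assoc, ← smul_baseVertex_add_eq (g := 1) (by omega) 1 (by rw [one_smul, ← h]),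
        one_smul]
    · rw [ih] at h'
      have e1 : i + n = m + 1 := congrArg level h'
      have e2 := congrArg level h
      rw [hl] at e2
      simp only [level_baseVertex, level_smul] at e2
      omega

/-- The walk is too short to descend below level `i`. At positive levels stabilizers of vertices `g
xₘ` with `g ∈ rayGroup` are inside `rayGroup`, so each edge stays in its orbits. -/
theorem exists_rayGroup_of_walk (hi : 0 < i) {w v : N.Vertex} (p : N.tree.Walk w v) :
    (∃ g ∈ N.rayGroup, ∃ m, p.length + i ≤ m ∧ w = g • N.baseVertex m) →
      ∃ g ∈ N.rayGroup, ∃ m, i ≤ m ∧ v = g • N.baseVertex m := by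
  induction p with
  | nil =>
    rintro ⟨g, hg, m, hm, h⟩
    exact ⟨g, hg, m, by omega, h⟩
  | @cons w z v hadj p ih =>
    rintro ⟨g, hg, m, hm, rfl⟩
    rw [SimpleGraph.Walk.length_cons] at hm
    refine ih ?_
    have key : ∀ (k : N.Gam) (l : ℕ), g • N.baseVertex m = k • N.baseVertex l →
        k ∈ N.rayGroup := by
      intro k l h
      obtain rfl : m = l := congrArg level h
      rw [smul_baseVertex_eq_iff] at h
      have := Subgroup.mul_mem _ hg (vertexGroup_le_rayGroup (by omega) h)
      rwa [mul_inv_cancel_left] at this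
    obtain ⟨k, l, ⟨h, rfl⟩ | ⟨rfl, h⟩⟩ := tree_adj_iff.1 hadj
    · have hl : m = l := congrArg level h
      exact ⟨k, key k l h, l + 1, by omega, rfl⟩
    · have hl : m = l + 1 := congrArg level h
      exact ⟨k, key k (l + 1) h, l, by omega, rfl⟩

theorem dist_baseVertex_le (m l : ℕ) :
    N.tree.dist (N.baseVertex m) (N.baseVertex (m + l)) ≤ l := by
  have : ∀ l, ∃ p : N.tree.Walk (N.baseVertex m) (N.baseVertex (m + l)), p.length = l := by
    intro l
    induction l with
    | zero => exact ⟨.nil, rfl⟩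
    | succ l ih =>
      obtain ⟨p, hp⟩ := ih
      exact ⟨p.concat ((isLevelRay_baseVertex m).2.1 l), by
        rw [SimpleGraph.Walk.length_concat, hp]⟩
  obtain ⟨p, hp⟩ := this l
  exact (SimpleGraph.dist_le p).trans hp.le

theorem level_le_add_length {v w : N.Vertex} (p : N.tree.Walk v w) :
    level w ≤ level v + p.length := by
  induction p with
  | nil => simp
  | @cons v z w hadj p ih =>
    rw [SimpleGraph.Walk.length_cons]
    have : level z ≤ level v + 1 := by
      obtain ⟨k, l, ⟨rfl, rfl⟩ | ⟨rfl, rfl⟩⟩ := tree_adj_iff.1 hadj <;>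
        simp only [level_smul, level_baseVertex] <;> omega
    omega

theorem level_le_add_dist (v w : N.Vertex) : level w ≤ level v + N.tree.dist v w := by
  obtain ⟨p, hp⟩ := (tree_preconnected v w).exists_walk_length_eq_dist
  rw [← hp]
  exact level_le_add_length p

theorem eventually_dist_le {g : N.Gam} (hg : g ∈ N.rayGroup) {m : ℕ} (him : i ≤ m) :
    ∀ᶠ n in Filter.atTop, N.tree.dist (g • N.baseVertex m) (N.baseVertex (i + n)) ≤ n := by
  obtain ⟨M, hM⟩ := mem_rayGroup.1 hg
  -- From here on `i + n` is at least both `m` and `M + 1`, so `g ∈ Γ_{M+1}` fixes `x_{i+n}`.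
  filter_upwards [Filter.eventually_ge_atTop (m + M + 1)] with n hn
  have h1 : N.baseVertex (i + n) = g • N.baseVertex (m + (i + n - m)) := by
    rw [Nat.add_sub_cancel' (by omega)]
    exact (smul_baseVertex_of_mem (vertexGroup_mono M.succ_pos (by omega) hM)).symm
  rw [h1]
  have h2 := dist_map (smulIso g) (N.baseVertex m) (N.baseVertex (m + (i + n - m)))
  rw [smulIso_apply, smulIso_apply] at h2
  rw [h2]
  exact (dist_baseVertex_le _ _).trans (by omega)

theorem mem_HB_iff (hi : 0 < i) {g : N.Gam} {v : N.Vertex} : v ∈ HB (g • N.baseVertex i) ↔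
    ∃ p ∈ N.rayGroup, ∃ m, i ≤ m ∧ v = (g * p) • N.baseVertex m := by
  constructor
  · intro hv
    have hv' := smul_mem_HB g⁻¹ hv
    rw [inv_smul_smul] at hv'
    obtain ⟨r, hr, hd⟩ := hv'
    obtain ⟨n, hn⟩ := hd.exists
    rw [hr.eq_baseVertex hi, SimpleGraph.dist_comm] at hn
    obtain ⟨q, hq⟩ := (tree_preconnected (N.baseVertex (i + n)) (g⁻¹ • v)).exists_walk_length_eq_dist
    obtain ⟨p, hp, m, hm, h⟩ := exists_rayGroup_of_walk hi q
      ⟨1, Subgroup.one_mem _, i + n, by omega, (one_smul _ _).symm⟩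
    exact ⟨p, hp, m, hm, by rw [mul_smul, ← h, smul_inv_smul]⟩
  · rintro ⟨p, hp, m, hm, rfl⟩
    rw [mul_smul]
    exact smul_mem_HB g ⟨_, isLevelRay_baseVertex i, eventually_dist_le hp hm⟩

/-- The upper bound `n` on the distance is `eventually_dist_le`; the lower bound holds because the
level changes by at most one along an edge. -/
theorem smul_mem_HS_of_mem_rayGroup {g p : N.Gam} (hp : p ∈ N.rayGroup) :
    (g * p) • N.baseVertex i ∈ HS (g • N.baseVertex i) := by
  rw [mul_smul]
  refine smul_mem_HS g ⟨_, isLevelRay_baseVertex i, ?_⟩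
  filter_upwards [eventually_dist_le (i := i) hp le_rfl] with n hn
  have := level_le_add_dist (p • N.baseVertex i) (N.baseVertex (i + n))
  simp only [level_smul, level_baseVertex] at this
  omega

theorem exists_of_mem_HS (hi : 0 < i) {g : N.Gam} {v : N.Vertex} (hl : level v = i)
    (hv : v ∈ HS (g • N.baseVertex i)) :
    ∃ p ∈ N.rayGroup, v = (g * p) • N.baseVertex i := by
  obtain ⟨p, hp, m, hm, rfl⟩ := (mem_HB_iff hi).1 (HS_subset_HB _ hv)
  obtain rfl : m = i := hl
  exact ⟨p, hp, rfl⟩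

theorem mem_HS_symm (hi : 0 < i) {x y : N.Vertex} (hx : level x = i) (hy : level y = i)
    (h : y ∈ HS x) : x ∈ HS y := by
  obtain ⟨g, hg⟩ := exists_eq_smul_baseVertex x
  rw [hx] at hg
  subst hg
  obtain ⟨p, hp, rfl⟩ := exists_of_mem_HS hi hy h
  have := smul_mem_HS_of_mem_rayGroup (i := i) (g := g * p) (Subgroup.inv_mem _ hp)
  rwa [mul_inv_cancel_right] at this

theorem exists_upper_of_mem_rayGroup (S : N.DirectSplitting) (hi : 0 < i) {p : N.Gam}
    (hp : p ∈ N.rayGroup) : ∃ w ∈ S.upper i, ∀ m, i ≤ m →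
      ∀ g : N.Gam, (g * p) • N.baseVertex m = (g * w) • N.baseVertex m := by
  obtain ⟨w, hw, b, hb, rfl⟩ := DirectSplitting.exists_mul_of_mem_rayGroup (S := S) (i := i) hp
  refine ⟨w, hw, fun m hm g => ?_⟩
  rw [← DirectSplitting.vertexGroup_eq hi] at hb
  rw [← mul_assoc, mul_smul (g * w), smul_baseVertex_of_mem (vertexGroup_mono hi hm hb)]

variable {N : NagaoRay.{u}} {i : ℕ} {S : N.DirectSplitting} {C : N.CosetReps}

open DirectSplitting

/-! ### The group `Δ` -/

theorem CosetReps.gam_mem (C : N.CosetReps) (s : Fin N.k) : C.gam s ∈ N.vertexGroup 0 := ⟨_, rfl⟩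

theorem CosetReps.exists_eq_mul (C : N.CosetReps) {z : N.Gam} (hz : z ∈ N.vertexGroup 0) :
    ∃ s, ∃ h ∈ N.edgeGroup, z = C.gam s * h := by
  obtain ⟨z, rfl⟩ := hz
  obtain ⟨s, hs⟩ := C.rep_bijective.2 (z : N.G 0 ⧸ N.inc₀.range)
  obtain ⟨h, hh⟩ := QuotientGroup.eq.1 hs
  refine ⟨s, N.of 0 (N.inc₀ h), ⟨h, rfl⟩, ?_⟩
  rw [hh, CosetReps.gam, ← map_mul, mul_inv_cancel_left]

theorem CosetReps.eq_of_inv_mul_mem (C : N.CosetReps) {s t : Fin N.k}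
    (h : (C.gam s)⁻¹ * C.gam t ∈ N.edgeGroup) : s = t := by
  refine C.rep_bijective.1 (QuotientGroup.eq.2 (mem_range_inc₀ ?_))
  rwa [map_mul, map_inv]

-- Modulo `H₀`, which normalizes `upper 0`, the elements of `Γ₀` are the `γₛ`; so the conjugates by
-- `Γ₀` that generate the kernel are those by the `γₛ`.
variable (S C) in
theorem Delta_eq_kern : Delta S C = S.kern 0 := by
  refine le_antisymm ((Subgroup.closure_le _).2 ?_) ?_
  · rintro _ ⟨j, s, hj, u, hu, rfl⟩
    exact conj_mem_kern (upper_le_kern (U_le_upper hj hu))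
  · rw [kern_eq_closure, Subgroup.closure_le]
    rintro _ ⟨a, ha, w, hw, rfl⟩
    have ha' : a ∈ N.vertexGroup 0 := by
      refine (iSup₂_le fun m hm => ?_ : N.lowGroup 0 ≤ _) ha
      rw [Nat.le_zero.1 hm]
    obtain ⟨s, h, hh, rfl⟩ := C.exists_eq_mul ha'
    have hle : S.upper 0 ≤ (Delta S C).comap (MulAut.conj (C.gam s)).toMonoidHom :=
      iSup₂_le fun j hj u hu => Subgroup.subset_closure ⟨j, s, hj, u, hu, rfl⟩
    have := hle (conj_mem_upper hh hw)
    have e : C.gam s * h * w * (C.gam s * h)⁻¹ = C.gam s * (h * w * h⁻¹) * (C.gam s)⁻¹ := by group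
    rw [e]
    exact this

theorem kern_le_kern_zero : S.kern i ≤ S.kern 0 := by
  rw [kern_eq_closure S i, Subgroup.closure_le]
  rintro _ ⟨a, -, w, hw, rfl⟩
  exact conj_mem_kern (upper_le_kern
    ((iSup₂_le fun j hj => U_le_upper (Nat.zero_lt_of_lt hj) : S.upper i ≤ S.upper 0) hw))

/-! ### The elements `δ` and `τ` -/

theorem upperGroup_le_kern (s : Fin N.k) : upperGroup S C i s ≤ S.kern i := by
  refine (Subgroup.closure_le _).2 ?_
  rintro _ ⟨j, hj, u, hu, rfl⟩
  exact conj_mem_kern (upper_le_kern (U_le_upper hj hu))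

theorem conj_mem_upperGroup {w : N.Gam} (hw : w ∈ S.upper i) (s : Fin N.k) :
    C.gam s * w * (C.gam s)⁻¹ ∈ upperGroup S C i s := by
  have hle : S.upper i ≤ (upperGroup S C i s).comap (MulAut.conj (C.gam s)).toMonoidHom :=
    iSup₂_le fun j hj u hu => Subgroup.subset_closure ⟨j, hj, u, hu, rfl⟩
  exact hle hw

/-- This and `IsDelta.smul_eq` are all that is needed about `δ_{x,y}`: the free action on components
then fixes the value of `τ`. -/
theorem IsDelta.mem_kern {x y : N.Vertex} {d : N.Gam} (h : IsDelta S C x y d) :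
    d ∈ S.kern (level x) := by
  obtain ⟨a, -, s, -, hd, -⟩ := h
  have := conj_mem_kern (g := a⁻¹) (upperGroup_le_kern s hd)
  have e : a⁻¹ * (a * d * a⁻¹) * a⁻¹⁻¹ = d := by group
  rwa [e] at this

theorem IsDelta.smul_eq {x y : N.Vertex} {d : N.Gam} (h : IsDelta S C x y d) : d • x = y := by
  obtain ⟨a, -, s, -, -, hd⟩ := h
  rw [smul_smul, inv_mul_cancel_right, mul_smul] at hd
  exact smul_left_cancel _ hd

variable (S C) in
theorem exists_isDelta (hi : 0 < i) {x y : N.Vertex} (hx : level x = i) (hy : level y = i)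
    (h : y ∈ HS x) : ∃ d, IsDelta S C x y d := by
  obtain ⟨g, hg⟩ := exists_eq_smul_baseVertex x
  rw [hx] at hg
  have hz : S.retr 0 g ∈ N.vertexGroup 0 := by
    refine (iSup₂_le fun m hm => ?_ : N.lowGroup 0 ≤ _) (retr_mem_lowGroup (S := S) g)
    rw [Nat.le_zero.1 hm]
  obtain ⟨s, k, hk, hs⟩ := C.exists_eq_mul hz
  -- The inverse of the `Δ`-part of `g`: what remains of `g` lies in `Γ₀`, hence equals some `γₛ` up
  -- to `H₀`, and `H₀` fixes `xᵢ`.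
  set a := (g * (S.retr 0 g)⁻¹)⁻¹ with ha
  have hax : a • x = C.gam s • N.baseVertex i := by
    rw [hg, smul_smul, ha, mul_inv_rev, inv_inv, inv_mul_cancel_right, hs, mul_smul,
      smul_baseVertex_of_mem (edgeGroup_le hi hk)]
  have hy' := smul_mem_HS a h
  rw [hax] at hy'
  obtain ⟨p, hp, hpy⟩ := exists_of_mem_HS hi (v := a • y) hy hy'
  obtain ⟨w, hw, hpw⟩ := exists_upper_of_mem_rayGroup S hi hp
  rw [hpw i le_rfl] at hpy
  have e : a * (a⁻¹ * (C.gam s * w * (C.gam s)⁻¹) * a) * a⁻¹ = C.gam s * w * (C.gam s)⁻¹ := by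
    group
  refine ⟨a⁻¹ * (C.gam s * w * (C.gam s)⁻¹) * a, a, ?_, s, ?_, ?_, ?_⟩
  · rw [Delta_eq_kern]
    exact Subgroup.inv_mem _ (mul_retr_inv_mem_kern g)
  · rw [hax, hx]
  · rw [e, hx]
    exact conj_mem_upperGroup hw s
  · rw [e, hax, hpy, smul_smul, inv_mul_cancel_right]

theorem isDelta_delta (hi : 0 < i) {x y : N.Vertex} (hx : level x = i) (hy : level y = i)
    (h : y ∈ HS x) : IsDelta S C x y (delta S C x y) :=
  Classical.epsilon_spec (exists_isDelta S C hi hx hy h)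

theorem compGraph_adj_iff (hi : 0 < i) {X Y : N.components i} : (N.compGraph i).Adj X Y ↔
    X ≠ Y ∧ ∃ x ∈ X.1, ∃ y ∈ Y.1, level x = i ∧ level y = i ∧ y ∈ HS x := by
  rw [compGraph, SimpleGraph.fromRel_adj]
  refine and_congr_right fun _ => or_iff_left_of_imp ?_
  rintro ⟨y, hy, x, hx, hly, hlx, h⟩
  exact ⟨x, hx, y, hy, hlx, hly, mem_HS_symm hi hly hlx h⟩

theorem comp_injective : Function.Injective (S.comp : S.kern i → N.components i) := by
  intro κ κ' h
  have h0 := smul_mem_cell (κ : N.Gam) (baseVertex_mem_cell (N := N) (Nat.zero_le i))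
  rw [mul_one] at h0
  refine Subtype.ext (eq_of_mem_cell κ.2 κ'.2 h0 ?_)
  have := congrArg Subtype.val h
  change N.cell i κ = N.cell i κ' at this
  rwa [← this]

theorem tauEdge_comp (hi : 0 < i) {κ κ' : S.kern i}
    (h : (N.compGraph i).Adj (S.comp κ) (S.comp κ')) :
    tauEdge S C i (S.comp κ) (S.comp κ') = κ' * (κ : N.Gam)⁻¹ := by
  obtain ⟨-, x, hx, y, hy, hlx, hly, hxy⟩ := (compGraph_adj_iff hi).1 h
  obtain ⟨x, hx, y, hy, hlx, hly, hxy, hd⟩ := Classical.epsilon_spec (p := fun d =>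
    ∃ x ∈ (S.comp κ).1, ∃ y ∈ (S.comp κ').1,
      level x = i ∧ level y = i ∧ y ∈ HS x ∧ d = delta S C x y)
    ⟨_, x, hx, y, hy, hlx, hly, hxy, rfl⟩
  have hδ := isDelta_delta (S := S) (C := C) hi hlx hly hxy
  have hmem := hδ.mem_kern
  rw [hlx] at hmem
  have hx' := smul_mem_cell (delta S C x y) hx
  rw [hδ.smul_eq] at hx'
  rw [eq_mul_inv_iff_mul_eq]
  exact (congrArg (· * (κ : N.Gam)) hd).trans
    (eq_of_mem_cell (Subgroup.mul_mem _ hmem κ.2) κ'.2 hx' hy)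

/-- The product telescopes along every walk, so geodesics and their uniqueness play no role. -/
theorem tauWalk_eq (hi : 0 < i) {X Y : N.components i} (p : (N.compGraph i).Walk X Y)
    {κ κ' : S.kern i} (hX : X = S.comp κ) (hY : Y = S.comp κ') :
    tauWalk S C i p = κ' * (κ : N.Gam)⁻¹ := by
  induction p generalizing κ with
  | nil =>
    rw [hX] at hY
    rw [comp_injective hY, mul_inv_cancel]
    rfl
  | @cons X Z Y h p ih =>
    obtain ⟨κ₁, hZ⟩ := exists_eq_comp (S := S) Z
    subst hX hY hZ
    rw [tauWalk, ih rfl rfl, tauEdge_comp hi h, mul_assoc, inv_mul_cancel_left]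

theorem compGraph_reachable (κ₀ κ : S.kern i) :
    (N.compGraph i).Reachable (S.comp κ₀) (S.comp (κ₀ * κ)) := by
  obtain ⟨κ, hκ⟩ := κ
  have hκ' := hκ
  rw [kern_eq_closure] at hκ'
  induction hκ' using Subgroup.closure_induction generalizing κ₀ with
  | mem g hg =>
    obtain ⟨a, ha, w, hw, rfl⟩ := hg
    by_cases hne : S.comp κ₀ = S.comp (κ₀ * ⟨_, hκ⟩)
    · rw [← hne]
    · refine SimpleGraph.Adj.reachable ((SimpleGraph.fromRel_adj _ _ _).2 ⟨hne, Or.inl ?_⟩)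
      -- Since `κ₀ a w = κ₀ (a w a⁻¹) a`, the second vertex lies in the translated component, and
      -- `w` moves vertices along the horosphere.
      refine ⟨(κ₀ * a : N.Gam) • N.baseVertex i, ⟨a, ha, i, le_rfl, rfl⟩,
        (κ₀ * a * w : N.Gam) • N.baseVertex i, ⟨a, ha, i, le_rfl, ?_⟩, rfl, rfl,
        smul_mem_HS_of_mem_rayGroup (upper_le_rayGroup hw)⟩
      congr 1
      rw [Subgroup.coe_mul]
      group
  | one =>
    have : κ₀ * ⟨1, hκ⟩ = κ₀ := mul_one κ₀
    rw [this]
  | mul x y hx hy ihx ihy =>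
    rw [← kern_eq_closure] at hx hy
    have : κ₀ * ⟨x * y, hκ⟩ = κ₀ * ⟨x, hx⟩ * ⟨y, hy⟩ := Subtype.ext (mul_assoc _ _ _).symm
    rw [this]
    exact (ihx κ₀ hx).trans (ihy (κ₀ * ⟨x, hx⟩) hy)
  | inv x hx ih =>
    rw [← kern_eq_closure] at hx
    have := ih (κ₀ * ⟨x⁻¹, hκ⟩) hx
    have e : κ₀ * ⟨x⁻¹, hκ⟩ * ⟨x, hx⟩ = κ₀ := Subtype.ext (inv_mul_cancel_right _ _)
    rw [e] at this
    exact this.symm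

theorem compGraph_preconnected (S : N.DirectSplitting) (i : ℕ) : (N.compGraph i).Preconnected := by
  intro X Y
  obtain ⟨κ, rfl⟩ := exists_eq_comp (S := S) X
  obtain ⟨κ', rfl⟩ := exists_eq_comp (S := S) Y
  have := compGraph_reachable κ (κ⁻¹ * κ')
  rwa [mul_inv_cancel_left] at this

/-- The element `τ_{X,Y}` is the unique element of the kernel that maps `X` to `Y`. -/
theorem tau_comp (hi : 0 < i) (κ κ' : S.kern i) :
    tau S C i (S.comp κ) (S.comp κ') = κ' * (κ : N.Gam)⁻¹ := by
  obtain ⟨p, hp⟩ := (compGraph_preconnected S i (S.comp κ) (S.comp κ')).exists_walk_length_eq_dist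
  obtain ⟨q, -, hq⟩ := Classical.epsilon_spec (p := fun t =>
    ∃ p : (N.compGraph i).Walk (S.comp κ) (S.comp κ'),
      p.length = (N.compGraph i).dist (S.comp κ) (S.comp κ') ∧ t = tauWalk S C i p) ⟨_, p, hp, rfl⟩
  exact hq.trans (tauWalk_eq hi q rfl rfl)

/-! ### The elements `γ` -/

theorem exists_mul_retr_zero (hi : 0 < i) {c : N.Gam} (hc : c ∈ N.vertexGroup i) :
    S.retr 0 c ∈ N.edgeGroup ∧ ∃ v ∈ S.lower i, c = v * S.retr 0 c := by
  rw [S.vertexGroup_eq hi] at hc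
  obtain ⟨v, hv, h, hh, rfl⟩ := exists_mul_of_mem_sup_lower hc
  have hle : S.lower i ≤ S.upper 0 := by
    refine iSup₂_le fun j _ => ?_
    rcases j.eq_zero_or_pos with rfl | hj
    · rw [S.U_zero]; exact bot_le
    · exact U_le_upper hj
  have : S.retr 0 (v * h) = h := by
    rw [map_mul, retr_of_mem_upper (hle hv), retr_of_mem_sup (Subgroup.mem_sup_left hh), one_mul]
  rw [this]
  exact ⟨hh, v, hv, rfl⟩

namespace VertexReps

variable (D : VertexReps S C)

theorem gam_smul (hi : 0 < i) {x : N.Vertex} (hx : level x = i) :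
    D.gam x • N.baseVertex i = x := by
  subst hx
  exact D.del_smul x hi

/-- The two sides differ by some `c ∈ Γᵢ`. Applying `retr 0` shows that the `H₀`-part of `c` is a
quotient of two coset representatives; these must coincide, so `c ∈ U₁ ⋯ Uᵢ`. -/
theorem exists_gam_smul_eq (hi : 0 < i) {x : N.Vertex} (hx : level x = i) {d : N.Gam}
    (hd : d ∈ S.kern 0) : ∃ c ∈ S.lower i, D.gam (d • x) = d * D.gam x * c := by
  have hdel : ∀ y : N.Vertex, level y = i → S.retr 0 (D.del y) = 1 := by
    intro y hy
    have := D.del_mem y (hy ▸ hi)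
    rwa [Delta_eq_kern] at this
  have hgam : ∀ y : N.Vertex, level y = i → S.retr 0 (D.gam y) = C.gam (D.idx y) := by
    intro y hy
    rw [gam, map_mul, hdel y hy, one_mul, retr_of_mem_zero (C.gam_mem _)]
  have h : (d * D.gam x)⁻¹ * D.gam (d • x) ∈ N.vertexGroup i := by
    rw [← smul_baseVertex_eq_iff, mul_smul, D.gam_smul hi hx, D.gam_smul hi (x := d • x) hx]
  obtain ⟨he, v, hv, hc⟩ := exists_mul_retr_zero (S := S) hi h
  have hr : S.retr 0 ((d * D.gam x)⁻¹ * D.gam (d • x)) =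
      (C.gam (D.idx x))⁻¹ * C.gam (D.idx (d • x)) := by
    rw [map_mul, map_inv, map_mul, hgam x hx, hgam (d • x) hx, MonoidHom.mem_ker.1 hd, one_mul]
  rw [hr] at he hc
  rw [C.eq_of_inv_mul_mem he, inv_mul_cancel, mul_one] at hc
  exact ⟨v, hv, by rw [← hc, mul_inv_cancel_left]⟩

theorem gam₂_smul (hi : 0 < i) {x x' : N.Vertex} (hx : level x = i) (hx' : level x' = i)
    {d d' : N.Gam} (hd : d ∈ S.kern 0) (hd' : d' ∈ S.kern 0) {v : N.Vertex} (hv : v ∈ HB x) :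
    D.gam₂ (d • x) (d' • x') • d • v = d' • D.gam₂ x x' • v := by
  obtain ⟨c, hc, h⟩ := D.exists_gam_smul_eq hi hx hd
  obtain ⟨c', hc', h'⟩ := D.exists_gam_smul_eq hi hx' hd'
  rw [← D.gam_smul hi hx] at hv
  obtain ⟨p, hp, m, hm, rfl⟩ := (mem_HB_iff hi).1 hv
  obtain ⟨w, hw, hpw⟩ := exists_upper_of_mem_rayGroup S hi hp
  have hcc : c' * c⁻¹ ∈ S.lower i := Subgroup.mul_mem _ hc' (Subgroup.inv_mem _ hc)
  -- The error term `c' c⁻¹` is moved past `w` by commutation and then fixes `xₘ`, because `m ≥ i`.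
  have e : D.gam₂ (d • x) (d' • x') * d * (D.gam x * w) =
      d' * D.gam₂ x x' * (D.gam x * w) * (c' * c⁻¹) := by
    rw [gam₂, gam₂, h, h']
    have := (commute_lower_upper hcc hw).eq
    calc _ = d' * D.gam x' * ((c' * c⁻¹) * w) := by group
      _ = _ := by rw [this]; group
  rw [hpw m hm, smul_smul, smul_smul, smul_smul, smul_smul, e, mul_smul,
    smul_baseVertex_of_mem (vertexGroup_mono hi hm (lower_le_vertexGroup hi hcc))]

theorem gam₂_smul_self (hi : 0 < i) {x x' : N.Vertex} (hx : level x = i) (hx' : level x' = i) :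
    D.gam₂ x x' • x = x' := by
  have h : (D.gam x)⁻¹ • x = N.baseVertex i := by
    rw [inv_smul_eq_iff, D.gam_smul hi hx]
  rw [gam₂, mul_smul, h, D.gam_smul hi hx']

end VertexReps

/-! ### Equivariant extension of a map of the component of `x₀`. -/

variable {N : NagaoRay.{u}} {i : ℕ} {S : N.DirectSplitting}

open DirectSplitting

namespace DirectSplitting

theorem mem_of_generators_mem (Q : Subgroup (S.kern i))
    (h : ∀ a ∈ N.lowGroup i, ∀ w ∈ S.upper i, ∀ h : a * w * a⁻¹ ∈ S.kern i, ⟨_, h⟩ ∈ Q)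
    (κ : S.kern i) : κ ∈ Q := by
  have hle : S.kern i ≤ Q.map (S.kern i).subtype := by
    conv_lhs => rw [kern_eq_closure]
    refine (Subgroup.closure_le _).2 ?_
    rintro _ ⟨a, ha, w, hw, rfl⟩
    have hk : a * w * a⁻¹ ∈ S.kern i := conj_mem_kern (upper_le_kern hw)
    exact ⟨⟨_, hk⟩, h a ha w hw hk, rfl⟩
  obtain ⟨κ', h', e⟩ := hle κ.2
  rwa [← Subtype.ext (a1 := κ') (a2 := κ) e]

variable (S i) in
/-- The component in the kernel of an element of `Γ`, with respect to the decomposition of `Γ`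
as a semidirect product of the kernel and the image of the retraction. -/
noncomputable def kernPart (g : N.Gam) : S.kern i := ⟨g * (S.retr i g)⁻¹, mul_retr_inv_mem_kern g⟩

theorem kernPart_mul_retr (g : N.Gam) : (S.kernPart i g : N.Gam) * S.retr i g = g :=
  inv_mul_cancel_right _ _

theorem kernPart_coe_mul (κ : S.kern i) (g : N.Gam) : S.kernPart i (κ * g) = κ * S.kernPart i g := by
  refine Subtype.ext ?_
  simp only [kernPart, map_mul, MonoidHom.mem_ker.1 κ.2, one_mul, Subgroup.coe_mul, mul_assoc]

theorem kernPart_of_mem {a : N.Gam} (ha : a ∈ N.lowGroup i) : S.kernPart i a = 1 := by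
  refine Subtype.ext ?_
  simp only [kernPart, retr_of_mem_lowGroup ha, mul_inv_cancel, Subgroup.coe_one]

theorem kernPart_mul_of_mem {b : N.Gam} (hb : b ∈ N.lowGroup i) (g : N.Gam) :
    S.kernPart i (g * b) = S.kernPart i g := by
  refine Subtype.ext ?_
  simp only [kernPart, map_mul, retr_of_mem_lowGroup hb]
  group

theorem kernPart_mul_upper {w : N.Gam} (hw : w ∈ S.upper i) (g : N.Gam) :
    S.kernPart i (g * w) = S.kernPart i g *
      ⟨S.retr i g * w * (S.retr i g)⁻¹, conj_mem_kern (upper_le_kern hw)⟩ := by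
  refine Subtype.ext ?_
  simp only [kernPart, map_mul, retr_of_mem_upper hw, Subgroup.coe_mul]
  group

/-- Every vertex is in a translate of the component of `x₀` or of a horoball attached to it. -/
theorem exists_eq_smul_of_kern (S : N.DirectSplitting) (hi : 0 < i) (v : N.Vertex) :
    ∃ (κ : S.kern i) (v₀ : N.Vertex), v = (κ : N.Gam) • v₀ ∧
      (v₀ ∈ N.cell i 1 ∨ ∃ x ∈ N.cell i 1, level x = i ∧ v₀ ∈ HB x) := by
  obtain ⟨g, hg⟩ := exists_eq_smul_baseVertex v
  refine ⟨S.kernPart i g, S.retr i g • N.baseVertex (level v), ?_, ?_⟩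
  · rw [smul_smul, kernPart_mul_retr, ← hg]
  · have hcell : ∀ m ≤ i, S.retr i g • N.baseVertex m ∈ N.cell i 1 := fun m hm =>
      ⟨S.retr i g, retr_mem_lowGroup g, m, hm, by rw [one_mul]⟩
    rcases le_total (level v) i with h | h
    · exact Or.inl (hcell _ h)
    · refine Or.inr ⟨S.retr i g • N.baseVertex i, hcell i le_rfl, rfl, ?_⟩
      exact (mem_HB_iff hi).2 ⟨1, Subgroup.one_mem _, level v, h, by rw [mul_one]⟩

end DirectSplitting

/-- The function `f` on the component of `x₀` is given by a level-preserving graph homomorphism,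
and it agrees with the elements `c x` at the vertices `x` of level `i`. -/
structure IsCellMap (i : ℕ) (f : N.Vertex → N.Vertex) (c : N.Vertex → N.Gam) : Prop where
  mem : ∀ v ∈ N.cell i 1, f v ∈ N.cell i 1
  level_eq : ∀ v ∈ N.cell i 1, level (f v) = level v
  adj : ∀ v ∈ N.cell i 1, ∀ w ∈ N.cell i 1, N.tree.Adj v w → N.tree.Adj (f v) (f w)
  smul : ∀ x ∈ N.cell i 1, level x = i → c x • x = f x

/-- The function `E` on `T` extends `f`, is equivariant with respect to `φ`, and is given by the
elements `c x` on the horoballs at the vertices `x` of level `i` in the component of `x₀`. -/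
structure IsExtension (S : N.DirectSplitting) (i : ℕ) (f : N.Vertex → N.Vertex)
    (c : N.Vertex → N.Gam) (φ : S.kern i →* S.kern i) (E : N.Vertex → N.Vertex) : Prop where
  twist : ∀ a ∈ N.lowGroup i, ∀ w ∈ S.upper i, ∀ h : a * w * a⁻¹ ∈ S.kern i,
    (φ ⟨_, h⟩ : N.Gam) = c (a • N.baseVertex i) * (a * w * a⁻¹) * (c (a • N.baseVertex i))⁻¹
  smul : ∀ (κ : S.kern i) (v : N.Vertex), E ((κ : N.Gam) • v) = (φ κ : N.Gam) • E v
  eq_cell : ∀ v ∈ N.cell i 1, E v = f v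
  eq_HB : ∀ x ∈ N.cell i 1, level x = i → ∀ v ∈ HB x, E v = c x • v

theorem smul_baseVertex_mem_cell_one {a : N.Gam} (ha : a ∈ N.lowGroup i) {m : ℕ} (hm : m ≤ i) :
    a • N.baseVertex m ∈ N.cell i 1 :=
  ⟨a, ha, m, hm, by rw [one_mul]⟩

theorem exists_isExtension (S : N.DirectSplitting) (hi : 0 < i) {f : N.Vertex → N.Vertex}
    {c : N.Vertex → N.Gam} (hf : IsCellMap i f c) :
    ∃ (φ : S.kern i →* S.kern i) (E : N.Vertex → N.Vertex), IsExtension S i f c φ E := by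
  obtain ⟨φ', hφ'⟩ := exists_twist S hi c
  have hmem : ∀ κ, φ' κ ∈ S.kern i := mem_of_generators_mem ((S.kern i).comap φ') (by
    intro a ha w hw h
    rw [Subgroup.mem_comap, hφ' a ha w hw h]
    exact conj_mem_kern h)
  let φ : S.kern i →* S.kern i := φ'.codRestrict _ hmem
  -- Write `g = κ a` with `κ` in the kernel and `a ∈ lowGroup i`. The value is `φ(κ)` applied to `f
  -- (a xₘ)` in the component, and to `c (a xᵢ) a xₘ` above it.
  let F : N.Gam → ℕ → N.Vertex := fun g m => (φ (S.kernPart i g) : N.Gam) •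
    if m ≤ i then f (S.retr i g • N.baseVertex m) else
      c (S.retr i g • N.baseVertex i) • S.retr i g • N.baseVertex m
  have hFlow : ∀ g m, ∀ u ∈ N.vertexGroup m, m ≤ i → F (g * u) m = F g m := by
    intro g m u hu hm
    have hu' := vertexGroup_le_lowGroup hm hu
    simp only [F, if_pos hm]
    rw [kernPart_mul_of_mem hu', map_mul, retr_of_mem_lowGroup hu', mul_smul,
      smul_baseVertex_of_mem hu]
  -- Above level `i` the stabilizer `Γₘ` also contains elements `w` of `upper i`, which change the
  -- kernel part of `g`. The twisting formula for `φ` is exactly what compensates for this.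
  have hFhigh : ∀ g m, ∀ u ∈ N.vertexGroup m, ¬ m ≤ i → F (g * u) m = F g m := by
    intro g m u hu hm
    obtain ⟨w, hw, b, hb, rfl⟩ := exists_mul_of_mem_rayGroup (S := S) (i := i)
      (vertexGroup_le_rayGroup (by omega) hu)
    have hb' := sup_le_lowGroup hb
    rw [← vertexGroup_eq hi] at hb
    have hbm := vertexGroup_mono hi (not_le.1 hm).le hb
    have hwm : w ∈ N.vertexGroup m := by
      have := Subgroup.mul_mem _ hu (Subgroup.inv_mem _ hbm)
      rwa [mul_inv_cancel_right] at this
    have e : (φ (S.kernPart i (g * w)) : N.Gam) = φ (S.kernPart i g) *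
        (c (S.retr i g • N.baseVertex i) * (S.retr i g * w * (S.retr i g)⁻¹) *
          (c (S.retr i g • N.baseVertex i))⁻¹) := by
      rw [kernPart_mul_upper hw, map_mul, Subgroup.coe_mul]
      congr 1
      exact hφ' _ (retr_mem_lowGroup g) w hw _
    simp only [F, if_neg hm]
    rw [← mul_assoc, kernPart_mul_of_mem hb', e, map_mul, map_mul, retr_of_mem_upper hw,
      retr_of_mem_lowGroup hb', mul_one, mul_smul _ b, smul_baseVertex_of_mem hb, mul_smul _ b,
      smul_baseVertex_of_mem hbm, smul_smul, smul_smul, smul_smul, smul_smul]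
    have : (φ (S.kernPart i g) : N.Gam) * (c (S.retr i g • N.baseVertex i) *
        (S.retr i g * w * (S.retr i g)⁻¹) * (c (S.retr i g • N.baseVertex i))⁻¹) *
        c (S.retr i g • N.baseVertex i) * S.retr i g =
        (φ (S.kernPart i g) : N.Gam) * c (S.retr i g • N.baseVertex i) * S.retr i g * w := by
      group
    rw [this, mul_smul _ w, smul_baseVertex_of_mem hwm]
  let E : N.Vertex → N.Vertex := fun v => F (exists_eq_smul_baseVertex v).choose (level v)
  have hE : ∀ g m, E (g • N.baseVertex m) = F g m := by
    intro g m
    have h := (exists_eq_smul_baseVertex (g • N.baseVertex m)).choose_spec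
    set g' := (exists_eq_smul_baseVertex (g • N.baseVertex m)).choose
    have hu : g⁻¹ * g' ∈ N.vertexGroup m := smul_baseVertex_eq_iff.1 h
    have hF : F (g * (g⁻¹ * g')) m = F g m := by
      by_cases hm : m ≤ i
      · exact hFlow g m _ hu hm
      · exact hFhigh g m _ hu hm
    rw [mul_inv_cancel_left] at hF
    exact hF
  refine ⟨φ, E, fun a ha w hw h => hφ' a ha w hw h, ?_, ?_, ?_⟩
  · intro κ v
    obtain ⟨g, hg⟩ := exists_eq_smul_baseVertex v
    rw [hg, smul_smul, hE, hE]
    simp only [F]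
    rw [kernPart_coe_mul, map_mul, map_mul, MonoidHom.mem_ker.1 κ.2, one_mul, Subgroup.coe_mul,
      mul_smul]
  · rintro _ ⟨a, ha, m, hm, rfl⟩
    rw [one_mul, hE]
    simp only [F, if_pos hm]
    rw [kernPart_of_mem ha, map_one, Subgroup.coe_one, one_smul, retr_of_mem_lowGroup ha]
  · rintro _ ⟨a, ha, m, -, rfl⟩ hl v hv
    obtain rfl : m = i := hl
    rw [one_mul] at hv ⊢
    obtain ⟨p, hp, l, hl, rfl⟩ := (mem_HB_iff hi).1 hv
    obtain ⟨w, hw, hpw⟩ := exists_upper_of_mem_rayGroup S hi hp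
    rw [hpw l hl, hE]
    have e : (φ (S.kernPart m (a * w)) : N.Gam) = c (a • N.baseVertex m) *
        (a * w * a⁻¹) * (c (a • N.baseVertex m))⁻¹ := by
      rw [kernPart_mul_upper hw, kernPart_of_mem ha, one_mul]
      simp only [retr_of_mem_lowGroup ha]
      exact hφ' a ha w hw _
    have hr : S.retr m (a * w) = a := by
      rw [map_mul, retr_of_mem_lowGroup ha, retr_of_mem_upper hw, mul_one]
    have hval : F (a * w) l = (φ (S.kernPart m (a * w)) : N.Gam) •
        c (a • N.baseVertex m) • a • N.baseVertex l := by
      by_cases hlm : l ≤ m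
      · obtain rfl : l = m := le_antisymm hlm hl
        simp only [F, if_pos hlm, hr]
        rw [hf.smul _ (smul_baseVertex_mem_cell_one ha le_rfl) rfl]
      · simp only [F, if_neg hlm, hr]
    rw [hval, e, smul_smul, smul_smul, smul_smul]
    congr 1
    group

namespace IsExtension

variable {f f' : N.Vertex → N.Vertex} {c c' : N.Vertex → N.Gam} {φ φ' : S.kern i →* S.kern i}
  {E E' : N.Vertex → N.Vertex}

theorem level_eq (hi : 0 < i) (hf : IsCellMap i f c) (h : IsExtension S i f c φ E)
    (v : N.Vertex) : level (E v) = level v := by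
  obtain ⟨κ, v, rfl, hv | ⟨x, hx, hxi, hv⟩⟩ := S.exists_eq_smul_of_kern hi v
  · rw [h.smul, level_smul, level_smul, h.eq_cell v hv, hf.level_eq v hv]
  · rw [h.smul, h.eq_HB x hx hxi v hv]
    rfl

theorem adj (hi : 0 < i) (hf : IsCellMap i f c) (h : IsExtension S i f c φ E)
    {v w : N.Vertex} (hvw : N.tree.Adj v w) : N.tree.Adj (E v) (E w) := by
  have key : ∀ (g : N.Gam) (m : ℕ),
      N.tree.Adj (E (g • N.baseVertex m)) (E (g • N.baseVertex (m + 1))) := by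
    intro g m
    have ha := retr_mem_lowGroup (S := S) (i := i) g
    have hadj := tree_adj_smul_baseVertex (S.retr i g) m
    rw [← kernPart_mul_retr (S := S) (i := i) g, mul_smul, mul_smul, h.smul, h.smul]
    refine tree_adj_smul _ ?_
    rcases Nat.lt_or_ge m i with hm | hm
    · have h1 := smul_baseVertex_mem_cell_one ha hm.le
      have h2 := smul_baseVertex_mem_cell_one ha (Nat.succ_le_of_lt hm)
      rw [h.eq_cell _ h1, h.eq_cell _ h2]
      exact hf.adj _ h1 _ h2 hadj
    · have hHB : ∀ l, i ≤ l → S.retr i g • N.baseVertex l ∈ HB (S.retr i g • N.baseVertex i) :=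
        fun l hl => (mem_HB_iff hi).2 ⟨1, Subgroup.one_mem _, l, hl, by rw [mul_one]⟩
      have h1 := smul_baseVertex_mem_cell_one ha le_rfl
      rw [h.eq_HB _ h1 rfl _ (hHB m hm), h.eq_HB _ h1 rfl _ (hHB (m + 1) (by omega))]
      exact tree_adj_smul _ hadj
  obtain ⟨g, m, ⟨rfl, rfl⟩ | ⟨rfl, rfl⟩⟩ := tree_adj_iff.1 hvw
  · exact key g m
  · exact (key g m).symm

/-- The point is `φ' ∘ φ = id`, checked on the generators `a w a⁻¹`: conjugation by `c x` turns a
generator attached to `x` into one attached to `f x`, and `c' (f x)` undoes it. -/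
theorem leftInverse (hi : 0 < i) (hf : IsCellMap i f c) (h : IsExtension S i f c φ E)
    (h' : IsExtension S i f' c' φ' E') (hff : ∀ v ∈ N.cell i 1, f' (f v) = v)
    (hcc : ∀ x ∈ N.cell i 1, level x = i → c' (f x) = (c x)⁻¹) : Function.LeftInverse E' E := by
  have hφ : ∀ κ, φ' (φ κ) = κ := by
    refine mem_of_generators_mem ((φ'.comp φ).eqLocus (MonoidHom.id _)) ?_
    intro a ha w hw hk
    have hx := smul_baseVertex_mem_cell_one ha le_rfl
    have hcx := hf.smul _ hx rfl
    have hc' := hcc _ hx rfl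
    obtain ⟨b, hb, m, -, hbm⟩ := hf.mem _ hx
    obtain rfl : i = m := by
      have := hf.level_eq _ hx
      rw [hbm] at this
      exact this.symm
    rw [one_mul] at hbm
    -- With `f (a xᵢ) = b xᵢ`, the elements `c (a xᵢ) a` and `b` differ by an element of `Γᵢ`, which
    -- normalizes `upper i`; so the image is again of the form `b w' b⁻¹`.
    have hγ : b⁻¹ * (c (a • N.baseVertex i) * a) ∈ N.vertexGroup i := by
      rw [← smul_baseVertex_eq_iff, mul_smul, hcx, hbm]
    have hw' := conj_mem_upper_of_mem_rayGroup (vertexGroup_le_rayGroup hi hγ) hw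
    have e := h.twist a ha w hw hk
    set γ := b⁻¹ * (c (a • N.baseVertex i) * a) with hγdef
    have e2 : (φ ⟨_, hk⟩ : N.Gam) = b * (γ * w * γ⁻¹) * b⁻¹ := by
      rw [e, hγdef]
      group
    have hk2 : b * (γ * w * γ⁻¹) * b⁻¹ ∈ S.kern i := e2 ▸ (φ ⟨_, hk⟩).2
    have e3 : φ ⟨_, hk⟩ = ⟨_, hk2⟩ := Subtype.ext e2
    refine Subtype.ext ?_
    change ((φ' (φ ⟨_, hk⟩) : S.kern i) : N.Gam) = a * w * a⁻¹
    rw [e3, h'.twist b hb _ hw' hk2, ← e2, e, ← hbm, hc']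
    group
  intro v
  obtain ⟨κ, v, rfl, hv | ⟨x, hx, hxi, hv⟩⟩ := S.exists_eq_smul_of_kern hi v
  · rw [h.smul, h'.smul, hφ, h.eq_cell v hv, h'.eq_cell _ (hf.mem v hv), hff v hv]
  · rw [h.smul, h'.smul, hφ, h.eq_HB x hx hxi v hv]
    have hv' := smul_mem_HB (c x) hv
    rw [hf.smul x hx hxi] at hv'
    rw [h'.eq_HB (f x) (hf.mem x hx) ((hf.level_eq x hx).trans hxi) _ hv', hcc x hx hxi,
      inv_smul_smul]

end IsExtension

/-- Mutually inverse maps of the component of `x₀` extend to an automorphism of the tree. -/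
theorem exists_iso_isExtension (S : N.DirectSplitting) (hi : 0 < i) {f f' : N.Vertex → N.Vertex}
    {c c' : N.Vertex → N.Gam} (hf : IsCellMap i f c) (hf' : IsCellMap i f' c')
    (hff : ∀ v ∈ N.cell i 1, f' (f v) = v) (hff' : ∀ v ∈ N.cell i 1, f (f' v) = v)
    (hcc : ∀ x ∈ N.cell i 1, level x = i → c' (f x) = (c x)⁻¹)
    (hcc' : ∀ x ∈ N.cell i 1, level x = i → c (f' x) = (c' x)⁻¹) :
    ∃ (φ : S.kern i →* S.kern i) (E : N.AutT), LevelPreserving E ∧ IsExtension S i f c φ E := by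
  obtain ⟨φ, E, h⟩ := exists_isExtension S hi hf
  obtain ⟨φ', E', h'⟩ := exists_isExtension S hi hf'
  have hl := h.leftInverse hi hf h' hff hcc
  have hr := h'.leftInverse hi hf' h hff' hcc'
  refine ⟨φ, ⟨⟨E, E', hl, hr⟩, fun {v w} => ⟨fun hvw => ?_, fun hvw => h.adj hi hf hvw⟩⟩,
    h.level_eq hi hf, h⟩
  have := h'.adj hi hf' hvw
  change N.tree.Adj (E' (E v)) (E' (E w)) at this
  rwa [hl, hl] at this

/-! ### The group `Lᵢ`. -/

variable {N : NagaoRay.{u}} {i : ℕ} {S : N.DirectSplitting} {C : N.CosetReps}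

open DirectSplitting

theorem mapComp_mul {h h' : N.AutT} (hl : LevelPreserving h) (hl' : LevelPreserving h')
    (hll : LevelPreserving (h * h')) (X : N.components i) :
    mapComp (h * h') hll X = mapComp h hl (mapComp h' hl' X) :=
  Subtype.ext (Set.image_image h h' X.1).symm

theorem mapComp_one (hl : LevelPreserving (1 : N.AutT)) (X : N.components i) :
    mapComp 1 hl X = X :=
  Subtype.ext (Set.image_id X.1)

theorem LevelPreserving.one : LevelPreserving (1 : N.AutT) := fun _ => rfl

theorem LevelPreserving.mul {h h' : N.AutT} (hl : LevelPreserving h) (hl' : LevelPreserving h') :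
    LevelPreserving (h * h') := fun v => (hl (h' v)).trans (hl' v)

theorem LevelPreserving.inv {h : N.AutT} (hl : LevelPreserving h) : LevelPreserving h⁻¹ :=
  fun v => (hl (h⁻¹ v)).symm.trans (congrArg level (h.apply_symm_apply v))

theorem mem_mapComp {h : N.AutT} (hl : LevelPreserving h) {X : N.components i} {v : N.Vertex}
    (hv : v ∈ X.1) : h v ∈ (mapComp h hl X).1 := Set.mem_image_of_mem h hv

namespace VertexReps

variable (D : VertexReps S C)

theorem gam₂_mul_gam₂ (x y z : N.Vertex) : D.gam₂ y z * D.gam₂ x y = D.gam₂ x z := by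
  simp only [gam₂]
  group

theorem gam₂_self (x : N.Vertex) : D.gam₂ x x = 1 := mul_inv_cancel _

theorem gam₂_inv (x y : N.Vertex) : (D.gam₂ x y)⁻¹ = D.gam₂ y x := by
  rw [gam₂, gam₂, mul_inv_rev, inv_inv]

theorem mem_L_iff {h : N.AutT} : h ∈ D.L i ↔ ∃ hl : LevelPreserving h,
    (∀ x : N.Vertex, level x = i → ∀ v ∈ HB x, h v = D.gam₂ x (h x) • v) ∧
    ∀ X Y : N.components i, ∀ v ∈ X.1,
      h (tau S C i X Y • v) = tau S C i (mapComp h hl X) (mapComp h hl Y) • h v := by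
  refine exists_congr fun hl => and_congr_right fun _ => forall₂_congr fun X Y => ?_
  constructor
  · intro H v hv
    have := H (h v) (mem_mapComp hl hv)
    rwa [h.symm_apply_apply] at this
  · rintro H _ ⟨v, hv, rfl⟩
    rw [h.symm_apply_apply]
    exact H v hv

/-- The set `Lᵢ` as a subgroup of the automorphism group of the tree. -/
def subgroupL (i : ℕ) : Subgroup N.AutT where
  carrier := D.L i
  one_mem' := by
    refine D.mem_L_iff.2 ⟨.one, fun x _ v _ => ?_, fun X Y v _ => ?_⟩
    · change v = D.gam₂ x x • v
      rw [gam₂_self, one_smul]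
    · rw [mapComp_one, mapComp_one]
      rfl
  mul_mem' := by
    intro h h' hh hh'
    obtain ⟨hl, ha, hb⟩ := D.mem_L_iff.1 hh
    obtain ⟨hl', ha', hb'⟩ := D.mem_L_iff.1 hh'
    refine D.mem_L_iff.2 ⟨hl.mul hl', fun x hx v hv => ?_, fun X Y v hv => ?_⟩
    · change h (h' v) = D.gam₂ x (h (h' x)) • v
      rw [ha (h' x) ((hl' x).trans hx) _ (map_mem_HB hl' hv), ha' x hx v hv, smul_smul,
        gam₂_mul_gam₂]
    · rw [mapComp_mul hl hl', mapComp_mul hl hl']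
      change h (h' _) = _ • h (h' v)
      rw [hb' X Y v hv, hb _ _ _ (mem_mapComp hl' hv)]
  inv_mem' := by
    intro h hh
    obtain ⟨hl, ha, hb⟩ := D.mem_L_iff.1 hh
    have hinv : ∀ v, h (h⁻¹ v) = v := h.apply_symm_apply
    have hcomp : ∀ X : N.components i, mapComp h hl (mapComp h⁻¹ hl.inv X) = X := by
      intro X
      have hl1 : LevelPreserving (h * h⁻¹) := hl.mul hl.inv
      rw [← mapComp_mul hl hl.inv hl1]
      refine Subtype.ext ((Set.image_congr fun v _ => hinv v).trans (Set.image_id' X.1))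
    refine D.mem_L_iff.2 ⟨hl.inv, fun x hx v hv => ?_, fun X Y v hv => ?_⟩
    · have := ha (h⁻¹ x) ((hl.inv x).trans hx) (h⁻¹ v) (map_mem_HB hl.inv hv)
      rw [hinv, hinv, ← inv_smul_eq_iff, gam₂_inv] at this
      exact this.symm
    · apply h.injective
      rw [hinv, hb _ _ _ (mem_mapComp hl.inv hv), hcomp, hcomp, hinv]

/-! ### Uniqueness of extensions -/

/-- Condition (a) at `x` determines the image of `y ∈ HS x`, hence the component that `Y` is sent
to. Condition (b) then determines the map on `Y = τ_{X,Y} X` from its restriction to `X`. -/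
theorem eqOn_of_adj (hi : 0 < i) {E E' : N.AutT} (hE : E ∈ D.L i) (hE' : E' ∈ D.L i)
    {X Y : N.components i} (hadj : (N.compGraph i).Adj X Y) (h : Set.EqOn E E' X.1) :
    Set.EqOn E E' Y.1 := by
  obtain ⟨hl, ha, hb⟩ := D.mem_L_iff.1 hE
  obtain ⟨hl', ha', hb'⟩ := D.mem_L_iff.1 hE'
  obtain ⟨-, x, hx, y, hy, hlx, hly, hxy⟩ := (compGraph_adj_iff hi).1 hadj
  have hy' : E y = E' y := by
    rw [ha x hlx y (HS_subset_HB x hxy), ha' x hlx y (HS_subset_HB x hxy), h hx]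
  have hX : mapComp E hl X = mapComp E' hl' X := Subtype.ext (Set.image_congr h)
  have hY : mapComp E hl Y = mapComp E' hl' Y :=
    components_eq_of_mem S (mem_mapComp hl hy) (hy' ▸ mem_mapComp hl' hy)
  obtain ⟨κ, rfl⟩ := exists_eq_comp (S := S) X
  obtain ⟨κ', rfl⟩ := exists_eq_comp (S := S) Y
  have hτ := tau_comp (S := S) (C := C) hi κ κ'
  intro v hv
  have hmem : (κ' * (κ : N.Gam)⁻¹)⁻¹ • v ∈ (S.comp κ).1 := by
    refine smul_mem_cell_iff.2 ?_
    rw [inv_inv, inv_mul_cancel_right]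
    exact hv
  have h1 := hb (S.comp κ) (S.comp κ') _ hmem
  have h2 := hb' (S.comp κ) (S.comp κ') _ hmem
  rw [hτ, smul_inv_smul] at h1 h2
  rw [h1, h2, hX, hY, h hmem]

theorem eq_of_eqOn (hi : 0 < i) {E E' : N.AutT} (hE : E ∈ D.L i) (hE' : E' ∈ D.L i)
    {X : N.components i} (h : Set.EqOn E E' X.1) : E = E' := by
  have hcomp : ∀ Y : N.components i, Set.EqOn E E' Y.1 := by
    intro Y
    obtain ⟨p⟩ := compGraph_preconnected S i X Y
    induction p with
    | nil => exact h
    | cons hadj p ih => exact ih (D.eqOn_of_adj hi hE hE' hadj h)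
  have hlow : ∀ v, level v ≤ i → E v = E' v := by
    intro v hv
    obtain ⟨κ, hκ, hvκ⟩ := S.exists_mem_cell hv
    exact hcomp (S.comp ⟨κ, hκ⟩) hvκ
  refine RelIso.ext fun v => ?_
  rcases le_total (level v) i with hv | hv
  · exact hlow v hv
  · obtain ⟨-, ha, -⟩ := hE
    obtain ⟨-, ha', -⟩ := hE'
    obtain ⟨g, hg⟩ := exists_eq_smul_baseVertex v
    have hHB : v ∈ HB (g • N.baseVertex i) :=
      (mem_HB_iff hi).2 ⟨1, Subgroup.one_mem _, level v, hv, by rw [mul_one, ← hg]⟩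
    rw [ha _ rfl v hHB, ha' _ rfl v hHB, hlow (g • N.baseVertex i) le_rfl]

/-! ### Existence of extensions -/

/-- A level-preserving automorphism that is equivariant with respect to an endomorphism of the
kernel is in `Lᵢ` if it satisfies the condition on the horoballs at one component. -/
theorem mem_L_of_equivariant (hi : 0 < i) {E : N.AutT} (hl : LevelPreserving E)
    (ψ : S.kern i →* S.kern i)
    (hψ : ∀ (κ : S.kern i) (v : N.Vertex), E ((κ : N.Gam) • v) = (ψ κ : N.Gam) • E v)
    (κ₀ : S.kern i)
    (hHB : ∀ x ∈ N.cell i κ₀, level x = i → ∀ v ∈ HB x, E v = D.gam₂ x (E x) • v) :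
    E ∈ D.L i := by
  refine D.mem_L_iff.2 ⟨hl, fun x hx v hv => ?_, fun X Y v hv => ?_⟩
  · obtain ⟨κ, hκ, hxκ⟩ := S.exists_mem_cell hx.le
    -- `d` takes the distinguished component to that of `x`; `x` and `v` are pulled back along it,
    -- and `gam₂_smul` carries the condition forward.
    set d : S.kern i := ⟨κ, hκ⟩ * κ₀⁻¹ with hd
    have hx₀ : (d : N.Gam)⁻¹ • x ∈ N.cell i κ₀ := by
      rw [smul_mem_cell_iff, inv_inv, hd, Subgroup.coe_mul, Subgroup.coe_inv,
        inv_mul_cancel_right]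
      exact hxκ
    obtain ⟨x, rfl⟩ : ∃ y, x = (d : N.Gam) • y := ⟨(d : N.Gam)⁻¹ • x, (smul_inv_smul _ _).symm⟩
    obtain ⟨v, rfl⟩ : ∃ y, v = (d : N.Gam) • y := ⟨(d : N.Gam)⁻¹ • v, (smul_inv_smul _ _).symm⟩
    have hv' := smul_mem_HB (d : N.Gam)⁻¹ hv
    rw [inv_smul_smul] at hx₀ hv'
    rw [inv_smul_smul] at hv'
    rw [level_smul] at hx
    rw [hψ, hψ, hHB x hx₀ hx v hv']
    exact (D.gam₂_smul hi hx ((hl x).trans hx) (kern_le_kern_zero d.2)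
      (kern_le_kern_zero (ψ d).2) hv').symm
  · obtain ⟨κ, rfl⟩ := exists_eq_comp (S := S) X
    obtain ⟨κ', rfl⟩ := exists_eq_comp (S := S) Y
    obtain ⟨μ, hμ⟩ := exists_eq_comp (S := S) (mapComp E hl (S.comp κ))
    obtain ⟨μ', hμ'⟩ := exists_eq_comp (S := S) (mapComp E hl (S.comp κ'))
    have hτ : (κ' * (κ : N.Gam)⁻¹ : N.Gam) = ((κ' * κ⁻¹ : S.kern i) : N.Gam) := rfl
    rw [hμ, hμ', tau_comp hi, tau_comp hi, hτ, hψ]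
    congr 1
    have h1 := mem_mapComp hl hv
    rw [hμ] at h1
    have h2 := smul_mem_cell (ψ (κ' * κ⁻¹) : N.Gam) h1
    have h3 : ((κ' * κ⁻¹ : S.kern i) : N.Gam) • v ∈ (S.comp κ').1 := by
      refine smul_mem_cell_iff.2 ?_
      rw [← hτ, mul_inv_rev, inv_inv, inv_mul_cancel_right]
      exact hv
    have h4 := mem_mapComp hl h3
    rw [hμ', hψ] at h4
    -- Both `ψ(κ' κ⁻¹) μ` and `μ'` label the component containing the image of `τ v`, so they
    -- coincide.
    rw [eq_mul_inv_iff_mul_eq]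
    exact eq_of_mem_cell (Subgroup.mul_mem _ (ψ (κ' * κ⁻¹)).2 μ.2) μ'.2 h2 h4

end VertexReps

/-! ### Transport of isomorphisms to the component of `x₀`. -/

open Classical in
/-- A map between two translates of the component of `x₀`, transported to this component. -/
noncomputable def transport {κ₀ κ₁ : N.Gam} (h : N.cell i κ₀ → N.cell i κ₁) (v : N.Vertex) :
    N.Vertex :=
  -- The default value is never used on the component of `x₀`, where the condition always holds.
  if hv : κ₀ • v ∈ N.cell i κ₀ then κ₁⁻¹ • (h ⟨_, hv⟩).1 else v

theorem smul_mem_cell_of_mem_one {κ : N.Gam} {v : N.Vertex} (hv : v ∈ N.cell i 1) :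
    κ • v ∈ N.cell i κ := by
  have := smul_mem_cell κ hv
  rwa [mul_one] at this

theorem inv_smul_mem_cell_one {κ : N.Gam} {v : N.Vertex} (hv : v ∈ N.cell i κ) :
    κ⁻¹ • v ∈ N.cell i 1 := by
  have := smul_mem_cell κ⁻¹ hv
  rwa [inv_mul_cancel] at this

theorem smul_transport {κ₀ κ₁ : N.Gam} (h : N.cell i κ₀ → N.cell i κ₁) {v : N.Vertex}
    (hv : v ∈ N.cell i 1) :
    κ₁ • transport h v = (h ⟨κ₀ • v, smul_mem_cell_of_mem_one hv⟩).1 := by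
  rw [transport, dif_pos (smul_mem_cell_of_mem_one hv), smul_inv_smul]

theorem transport_mem {κ₀ κ₁ : N.Gam} (h : N.cell i κ₀ → N.cell i κ₁) {v : N.Vertex}
    (hv : v ∈ N.cell i 1) : transport h v ∈ N.cell i 1 := by
  rw [transport, dif_pos (smul_mem_cell_of_mem_one hv)]
  exact inv_smul_mem_cell_one (h _).2

theorem transport_transport {κ₀ κ₁ : N.Gam} (h : N.cell i κ₀ → N.cell i κ₁)
    (h' : N.cell i κ₁ → N.cell i κ₀) (hh : ∀ v, h' (h v) = v) {v : N.Vertex}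
    (hv : v ∈ N.cell i 1) : transport h' (transport h v) = v := by
  refine smul_left_cancel κ₀ ?_
  rw [smul_transport h' (transport_mem h hv)]
  have : (⟨κ₁ • transport h v, smul_mem_cell_of_mem_one (transport_mem h hv)⟩ : N.cell i κ₁) =
      h ⟨κ₀ • v, smul_mem_cell_of_mem_one hv⟩ := Subtype.ext (smul_transport h hv)
  rw [this, hh]

namespace VertexReps

variable (D : VertexReps S C)

/-- The elements `γ_{x,h(x)}`, transported to the component of `x₀`. -/
noncomputable def transportGam {κ₀ κ₁ : N.Gam} (h : N.cell i κ₀ → N.cell i κ₁) (x : N.Vertex) :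
    N.Gam :=
  κ₁⁻¹ * D.gam₂ (κ₀ • x) (κ₁ • transport h x) * κ₀

theorem transportGam_transport {κ₀ κ₁ : N.Gam} (h : N.cell i κ₀ → N.cell i κ₁)
    (h' : N.cell i κ₁ → N.cell i κ₀) (hh : ∀ v, h' (h v) = v) {v : N.Vertex}
    (hv : v ∈ N.cell i 1) : D.transportGam h' (transport h v) = (D.transportGam h v)⁻¹ := by
  rw [transportGam, transportGam, transport_transport h h' hh hv, mul_inv_rev, mul_inv_rev,
    gam₂_inv, inv_inv, mul_assoc]

theorem isCellMap_transport (hi : 0 < i) {κ₀ κ₁ : N.Gam}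
    (h : N.tree.induce (N.cell i κ₀) ≃g N.tree.induce (N.cell i κ₁))
    (hl : ∀ v, level (h v).1 = level v.1) : IsCellMap i (transport h) (D.transportGam h) := by
  have hlev : ∀ v ∈ N.cell i 1, level (transport h v) = level v := by
    intro v hv
    rw [← level_smul κ₁, smul_transport h hv, hl]
    rfl
  refine ⟨fun v hv => transport_mem h hv, hlev, fun v hv w hw hvw => ?_, fun x hx hxi => ?_⟩
  · have h1 := h.map_adj_iff (v := ⟨κ₀ • v, smul_mem_cell_of_mem_one hv⟩)
      (w := ⟨κ₀ • w, smul_mem_cell_of_mem_one hw⟩) |>.2 (tree_adj_smul κ₀ hvw)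
    have h2 : N.tree.Adj (κ₁ • transport h v) (κ₁ • transport h w) := by
      rw [smul_transport h hv, smul_transport h hw]
      exact h1
    have h3 := tree_adj_smul κ₁⁻¹ h2
    rwa [inv_smul_smul, inv_smul_smul] at h3
  · rw [transportGam, mul_smul, mul_smul, D.gam₂_smul_self hi (x := κ₀ • x) hxi
      (x' := κ₁ • transport h x) ((hlev x hx).trans hxi), inv_smul_smul]

theorem exists_extension (hi : 0 < i) (κ₀ κ₁ : S.kern i)
    (h : N.tree.induce (N.cell i κ₀) ≃g N.tree.induce (N.cell i κ₁))
    (hl : ∀ v, level (h v).1 = level v.1) : ∃ E ∈ D.L i, ∀ v, E v.1 = (h v).1 := by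
  have hl' : ∀ v, level (h.symm v).1 = level v.1 := by
    intro v
    rw [← hl, h.apply_symm_apply]
  obtain ⟨φ, E, hE, hext⟩ := exists_iso_isExtension S hi (D.isCellMap_transport hi h hl)
    (D.isCellMap_transport hi h.symm hl')
    (fun v hv => transport_transport h h.symm h.symm_apply_apply hv)
    (fun v hv => transport_transport h.symm h h.apply_symm_apply hv)
    (fun v hv _ => D.transportGam_transport h h.symm h.symm_apply_apply hv)
    (fun v hv _ => D.transportGam_transport h.symm h h.apply_symm_apply hv)
  set E₁ : N.AutT := smulIso (κ₁ : N.Gam) * E * smulIso (κ₀ : N.Gam)⁻¹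
  have hE₁ : ∀ v, E₁ v = (κ₁ : N.Gam) • E ((κ₀ : N.Gam)⁻¹ • v) := fun v => rfl
  have hcell : ∀ v (hv : v ∈ N.cell i κ₀), E₁ v = (h ⟨v, hv⟩).1 := by
    intro v hv
    have h1 := inv_smul_mem_cell_one hv
    rw [hE₁, hext.eq_cell _ h1, smul_transport h h1]
    congr 2
    exact Subtype.ext (smul_inv_smul _ _)
  refine ⟨E₁, ?_, fun v => hcell v.1 v.2⟩
  -- Undoing the transport by `κ₀` and `κ₁` turns `φ` into `κ ↦ κ₁ φ(κ₀⁻¹ κ κ₀) κ₁⁻¹`.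
  refine D.mem_L_of_equivariant hi
    (((levelPreserving_smulIso _).mul hE).mul (levelPreserving_smulIso _))
    ((MulAut.conj κ₁).toMonoidHom.comp (φ.comp (MulAut.conj κ₀⁻¹).toMonoidHom)) ?_ κ₀ ?_
  · intro κ v
    have h1 : (κ₀ : N.Gam)⁻¹ • (κ : N.Gam) • v =
        ((κ₀⁻¹ * κ * κ₀ : S.kern i) : N.Gam) • (κ₀ : N.Gam)⁻¹ • v := by
      rw [smul_smul, smul_smul]
      congr 1
      simp only [Subgroup.coe_mul, Subgroup.coe_inv]
      group
    rw [hE₁, hE₁, h1, hext.smul, smul_smul, smul_smul]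
    congr 1
    simp only [MonoidHom.comp_apply, MulEquiv.toMonoidHom_eq_coe, MonoidHom.coe_coe,
      MulAut.conj_apply, inv_inv, Subgroup.coe_mul, Subgroup.coe_inv]
    group
  · intro x hx hxi v hv
    have h1 := inv_smul_mem_cell_one hx
    rw [hE₁ v, hext.eq_HB _ h1 hxi _ (smul_mem_HB _ hv), transportGam, smul_smul, smul_smul,
      smul_transport (h : N.cell i κ₀ → N.cell i κ₁) h1]
    have h2 : (h ⟨(κ₀ : N.Gam) • (κ₀ : N.Gam)⁻¹ • x, smul_mem_cell_of_mem_one h1⟩).1 = E₁ x := by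
      rw [hcell x hx]
      congr 2
      exact Subtype.ext (smul_inv_smul _ _)
    rw [h2, smul_inv_smul]
    congr 1
    group

end VertexReps

end NagaoRay

/-- `Lᵢ` is a group, and every level-preserving isomorphism between two components of `Tᵢ`
extends uniquely to an element of `Lᵢ`. -/
theorem mainTheorem7 (N : NagaoRay.{u}) (S : N.DirectSplitting) (C : N.CosetReps)
    (D : NagaoRay.VertexReps S C) (i : ℕ) (hi : 0 < i) :
    (∃ K : Subgroup N.AutT, (K : Set N.AutT) = D.L i) ∧
    ∀ X ∈ N.components i, ∀ Y ∈ N.components i,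
      ∀ h : N.tree.induce X ≃g N.tree.induce Y,
        (∀ v : X, NagaoRay.level (h v).1 = NagaoRay.level v.1) →
        ∃! E : N.AutT, E ∈ D.L i ∧ ∀ v : X, E v.1 = (h v).1 := by
  refine ⟨⟨D.subgroupL i, rfl⟩, fun X hX Y hY h hl => ?_⟩
  obtain ⟨κ₀, hκ₀, rfl⟩ := (NagaoRay.DirectSplitting.mem_components_iff S).1 hX
  obtain ⟨κ₁, hκ₁, rfl⟩ := (NagaoRay.DirectSplitting.mem_components_iff S).1 hY
  obtain ⟨E, hE, hEh⟩ := D.exists_extension hi ⟨κ₀, hκ₀⟩ ⟨κ₁, hκ₁⟩ h hl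
  refine ⟨E, ⟨hE, hEh⟩, fun E' ⟨hE', hEh'⟩ => ?_⟩
  refine D.eq_of_eqOn hi hE' hE (X := ⟨_, hX⟩) fun v hv => ?_
  exact (hEh' ⟨v, hv⟩).trans (hEh ⟨v, hv⟩).symm
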